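/- Let \(\mathcal X,\mathcal Y\) be finite-dimensional real inner product spaces (for instance \(\mathbb R^n,\mathbb R^m\)). Let \(f:\mathcal X\to\mathbb R\cup\{\infty\}\) and \(g:\mathcal Y\to\mathbb R\cup\{\infty\}\) be proper, lower semicontinuous and convex, let \(f\) be strongly convex with modulus \(\mu_f>0\) (i.e. \(f-\frac{\mu_f}{2}\|\cdot\|^2\) is convex), and let \(A:\mathcal X\to\mathcal Y\) be linear with \(A\,\mathrm{dom}\,f\cap\mathrm{dom}\,g\neq\emptyset\). Let \(x_\star\) be the (unique) minimizer of \(f+g\circ A\). Let \(\psi(y)=f^*(-A^\top y)+g^*(y)\) be the dual objective, where \(^*\) denotes the Fenchel conjugate, and for \(\gamma>0\) let \[\mathcal L_\gamma(x,z,y)=f(x)+g(z)+\langle y,Ax-z\rangle+\tfrac{\gamma}{2}\|Ax-z\|^2 .\] The Newton-type alternating minimization algorithm (NAMA) has parameters \(\beta\in(0,1)\) and \(\gamma>0\) with \(\gamma\|A\|^2<\mu_f\), and starts from an arbitrary \(y^0\in\mathcal Y\). At iteration \(k\ge 0\): 1. Compute \(x^k=\operatorname{argmin}_x\{f(x)+\langle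 y^k,Ax\rangle\}\) and \(z^k=\operatorname{argmin}_z\mathcal L_\gamma(x^k,z,y^k)\). 2. Choose an arbitrary direction \(d^k\in\mathcal Y\). 3. Find the largest \(\tau_k\in\{\beta^i: i=0,1,2,\dots\}\) such that \(\mathcal L_\gamma(\tilde x^k,\tilde z^k,\tilde y^k)\ge\mathcal L_\gamma(x^k,z^k,y^k)\), where \(\tilde y^k=y^k+\tau_kd^k+\gamma(1-\tau_k)(Ax^k-z^k)\), \(\tilde x^k=\operatorname{argmin}_x\{f(x)+\langle\tilde y^k,Ax\rangle\}\) and \(\tilde z^k=\operatorname{argmin}_z\mathcal L_\gamma(\tilde x^k,z,\tilde y^k)\). 4. Set \(y^{k+1}=\tilde y^k+\gamma(A\tilde x^k-\tilde z^k)\). If \(Ax^k=z^k\) (so that \((x^k,y^k)\) is a primal-dual solution), the method may also stop; the iterates are then continued as constant sequences. A set-valued mapping \(F\) is called calm at \(\bar a\) if for every \(\bar b\in F(\bar a)\) there are a neighborhood \(U\) of \(\bar b\) and \(L\ge 0\) such that \(F(a)\cap U\subseteq F(\bar a)+\{v:\|v\|\le L\|a-\bar a\|\}\) for all \(a\). **Theorem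 (local linear convergence).** Suppose that - \(0\in\operatorname{int}(\mathrm{dom}\,g-A\,\mathrm{dom}\,f)\); - \(0\in\operatorname{ri}\,\partial(f+g\circ A)(x_\star)\) (strict complementarity); - \(\partial f\) is calm at \(x_\star\) and \(\partial g\) is calm at \(Ax_\star\). Then, for every sequence of iterates generated by NAMA, \(\inf\psi\) is finite, \(\psi(y^k)\) is finite for all large \(k\), and eventually \(\psi(y^k)\to\inf\psi\) with Q-linear rate, i.e. \(\psi(y^k)\to\inf\psi\) and there are \(c\in(0,1)\) and \(K\) such that \[\psi(y^{k+1})-\inf\psi\le c\,\bigl(\psi(y^k)-\inf\psi\bigr)\qquad\text{for all }k\ge K .\] Moreover \(x^k\to x_\star\) with R-linear rate, i.e. there are \(C\) and \(\rho\in(0,1)\) such that \(\|x^k-x_\star\|\le C\rho^k\) for all large \(k\). -/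

import Mathlib

open Set Filter Topology
open scoped Pointwise

namespace NAMA

noncomputable section

section ConvexAnalysis

variable {E : Type*} [NormedAddCommGroup E] [InnerProductSpace ℝ E]

/-- Effective domain of an extended-real-valued function. -/
def dom (h : E → EReal) : Set E := {x | h x < ⊤}

/-- Convexity of an extended-real-valued function: its epigraph is convex. -/
def ConvexFun (h : E → EReal) : Prop :=
  Convex ℝ {p : E × ℝ | h p.1 ≤ (p.2 : EReal)}

/-- `h` has convexity modulus `c`: the function `h - (c/2)‖·‖²` is convex. -/
def HasConvexityModulus (c : ℝ) (h : E → EReal) : Prop :=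
  ConvexFun fun x => h x - ((c / 2 * ‖x‖ ^ 2 : ℝ) : EReal)

/-- The class `Γ₀` of proper, closed (lower semicontinuous), convex functions with values in
`ℝ ∪ {∞}`. -/
structure IsGammaZero (h : E → EReal) : Prop where
  ne_bot : ∀ x, h x ≠ ⊥
  nonempty_dom : (dom h).Nonempty
  lsc : LowerSemicontinuous h
  convex : ConvexFun h

/-- Fenchel conjugate `h*(y) = sup_x (⟨x, y⟩ - h x)`. -/
def conj (h : E → EReal) (y : E) : EReal :=
  ⨆ x, ((inner ℝ x y : ℝ) : EReal) - h x

/-- Convex subdifferential: `v ∈ ∂h(x)` iff `h x' ≥ h x + ⟨v, x' - x⟩` for all `x'`.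
For proper `h` it is empty outside `dom h`. -/
def subdiff (h : E → EReal) (x : E) : Set E :=
  {v | ∀ x', h x + ((inner ℝ v (x' - x) : ℝ) : EReal) ≤ h x'}

/-- A set-valued mapping `F` is calm at `a` for `b`: there are a neighborhood `U` of `b` and a
constant `L ≥ 0` with `F a' ∩ U ⊆ F a + L ‖a' - a‖ 𝔹` for all `a'`, where `𝔹` is the closed
unit ball. -/
def CalmAtFor (F : E → Set E) (a b : E) : Prop :=
  ∃ U ∈ 𝓝 b, ∃ L : ℝ, 0 ≤ L ∧ ∀ a', F a' ∩ U ⊆ F a + Metric.closedBall 0 (L * ‖a' - a‖)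

/-- `F` is calm at `a`: it is calm at `a` for every `b ∈ F a`. -/
def CalmAt (F : E → Set E) (a : E) : Prop :=
  ∀ b ∈ F a, CalmAtFor F a b

/-- `u` converges to `l` with (eventual) Q-linear rate. -/
def QLinear (u : ℕ → ℝ) (l : ℝ) : Prop :=
  Tendsto u atTop (𝓝 l) ∧
    ∃ c ∈ Ioo (0 : ℝ) 1, ∀ᶠ k in atTop, |u (k + 1) - l| ≤ c * |u k - l|

/-- `u` converges to `l` with (eventual) R-linear rate: the error is bounded by a geometric
sequence. -/
def RLinear (u : ℕ → E) (l : E) : Prop :=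
  Tendsto u atTop (𝓝 l) ∧
    ∃ C : ℝ, ∃ ρ ∈ Ioo (0 : ℝ) 1, ∀ᶠ k in atTop, ‖u k - l‖ ≤ C * ρ ^ k

end ConvexAnalysis

section Algorithm

variable {X Y : Type*} [NormedAddCommGroup X] [InnerProductSpace ℝ X]
  [NormedAddCommGroup Y] [InnerProductSpace ℝ Y]

/-- Primal objective `f + g ∘ A`. -/
def primal (f : X → EReal) (g : Y → EReal) (A : X →L[ℝ] Y) (x : X) : EReal :=
  f x + g (A x)

/-- Dual objective `ψ(y) = f*(-Aᵀ y) + g*(y)`. -/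
def dual [FiniteDimensional ℝ X] [FiniteDimensional ℝ Y]
    (f : X → EReal) (g : Y → EReal) (A : X →L[ℝ] Y) (y : Y) : EReal :=
  conj f (-(LinearMap.adjoint (A : X →ₗ[ℝ] Y) y)) + conj g y

/-- Augmented Lagrangian `f x + g z + ⟨y, A x - z⟩ + (γ/2)‖A x - z‖²`. -/
def augLag (f : X → EReal) (g : Y → EReal) (A : X →L[ℝ] Y) (γ : ℝ) (x : X) (z y : Y) : EReal :=
  f x + g z + ((inner ℝ y (A x - z) + γ / 2 * ‖A x - z‖ ^ 2 : ℝ) : EReal)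

/-- `(x, z)` is the result of the alternating minimization at `y`:
`x = argmin {f + ⟨y, A ·⟩}` and then `z = argmin L_γ(x, ·, y)`. -/
def AltMin (f : X → EReal) (g : Y → EReal) (A : X →L[ℝ] Y) (γ : ℝ) (y : Y) (x : X) (z : Y) :
    Prop :=
  IsMinOn (fun x' => f x' + ((inner ℝ y (A x') : ℝ) : EReal)) univ x ∧
    IsMinOn (fun z' => augLag f g A γ x z' y) univ z

/-- Trial dual point `y + τ d + γ (1 - τ) (A x - z)` of the line search. -/
def trial (A : X →L[ℝ] Y) (γ : ℝ) (y d : Y) (x : X) (z : Y) (τ : ℝ) : Y :=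
  y + τ • d + (γ * (1 - τ)) • (A x - z)

/-- The stepsize `τ` passes the line-search test, with `(xt, zt)` obtained by alternating
minimization at the trial point. -/
def Accepts (f : X → EReal) (g : Y → EReal) (A : X →L[ℝ] Y) (γ : ℝ) (y d : Y) (x : X) (z : Y)
    (τ : ℝ) (xt : X) (zt : Y) : Prop :=
  AltMin f g A γ (trial A γ y d x z τ) xt zt ∧
    augLag f g A γ x z y ≤ augLag f g A γ xt zt (trial A γ y d x z τ)

/-- `y'` is obtained from `y` by one line-search step of the method along the direction `d`, where
`(x, z)` is the result of the alternating minimization at `y`: `τ` is the largest accepted element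
of `{β ^ i | i ∈ ℕ}` and `y' = yt + γ (A xt - zt)`, with `yt` the accepted trial point and
`(xt, zt)` the result of the alternating minimization there. -/
def LineSearchStep (f : X → EReal) (g : Y → EReal) (A : X →L[ℝ] Y) (γ β : ℝ)
    (y d : Y) (x : X) (z y' : Y) : Prop :=
  ∃ (τ : ℝ) (xt : X) (zt : Y),
    IsGreatest {t : ℝ | (∃ i : ℕ, t = β ^ i) ∧ ∃ x' z', Accepts f g A γ y d x z t x' z'} τ ∧
    Accepts f g A γ y d x z τ xt zt ∧
    y' = trial A γ y d x z τ + γ • (A xt - zt)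

/-- `(y k, x k, z k)` are the iterates of NAMA with stepsize `γ`, backtracking ratio `β` and an
arbitrary choice of directions. If `A x k = z k`, that is, if `(x k, y k)` is already a
primal-dual solution, then the method may also stop, which is encoded by a constant continuation;
this covers runs in which no stepsize would be accepted at a solution. -/
structure IsRun (f : X → EReal) (g : Y → EReal) (A : X →L[ℝ] Y) (γ β : ℝ)
    (y : ℕ → Y) (x : ℕ → X) (z : ℕ → Y) : Prop where
  altMin : ∀ k, AltMin f g A γ (y k) (x k) (z k)
  step : ∀ k, (∃ d : Y, LineSearchStep f g A γ β (y k) d (x k) (z k) (y (k + 1))) ∨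
    (A (x k) = z k ∧ y (k + 1) = y k)

end Algorithm

end

end NAMA

namespace NAMA

/-! ### Subgradients, conjugates, calmness on compact sets -/

section Subgradients

/-! Write `s = A x - z` for the residual of an alternating minimization and `l = -lag` for the
negative augmented Lagrangian there, an envelope of the dual objective `ψ`. Three inequalities drive
the proof.

Descent: `ψ (y k) ≥ l k + γ/2 ‖s k‖²` by Fenchel–Young, and `ψ (y (k+1)) ≤ l k`
(`OptCond.dual_add_le`). The latter combines strong convexity of `f` with `γ‖A‖² ≤ μ`, which bounds
`ψ` after the closing step by the envelope at the trial point; the line search keeps that envelope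
below `l k`. The direction is therefore irrelevant.

Growth: `l k - inf ψ ≤ ‖y k - q‖² / (2γ)` for every multiplier `q` (`OptCond.neg_lag_le`).

Error bound: near the multipliers some `q` satisfies `‖y k - q‖ ≤ C ‖s k‖` (`exists_error_bound`).
Inserted into growth and descent, it yields a contraction of `ψ - inf ψ`; strong convexity transfers
the rate to `x`.

For the error bound, calmness replaces the subgradients at `x` and `z` by elements of `∂f(xs)` and
`∂g(A xs)`, up to errors linear in `‖x - xs‖` and `‖s‖`. Strict complementarity makes the two sets
defining the multipliers linearly regular (`exists_multiplier_norm_sub_le`). Strong monotonicity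
then bounds `‖x - xs‖` itself by `‖s‖`.

The iterates do reach that neighborhood: the interior condition bounds dual sublevel sets,
telescoping the descent gives `s → 0`, hence `x → xs`, and all cluster points of `y` are
multipliers. -/

theorem mem_dom_iff {E : Type*} {h : E → EReal} {x : E} : x ∈ dom h ↔ h x ≠ ⊤ :=
  lt_top_iff_ne_top (a := h x)

theorem coe_toReal_of_mem_dom {E : Type*} {h : E → EReal} (hb : ∀ x, h x ≠ ⊥) {x : E}
    (hx : x ∈ dom h) : ((h x).toReal : EReal) = h x :=
  EReal.coe_toReal (mem_dom_iff.1 hx) (hb x)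

/-- A mapping that is calm at `a` is calm uniformly around compact subsets of its value. -/
theorem CalmAt.exists_of_isCompact {E : Type*} [NormedAddCommGroup E] {F : E → Set E} {a : E} (hF : CalmAt F a) {K : Set E}
    (hK : IsCompact K) (hKF : K ⊆ F a) :
    ∃ U, IsOpen U ∧ K ⊆ U ∧ ∃ L : ℝ, 0 ≤ L ∧ ∀ a', ∀ v ∈ F a', v ∈ U →
      ∃ b ∈ F a, ‖v - b‖ ≤ L * ‖a' - a‖ := by
  refine hK.induction_on (p := fun K => ∃ U, IsOpen U ∧ K ⊆ U ∧ ∃ L : ℝ, 0 ≤ L ∧ ∀ a',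
      ∀ v ∈ F a', v ∈ U → ∃ b ∈ F a, ‖v - b‖ ≤ L * ‖a' - a‖) ?_ ?_ ?_ ?_
  · exact ⟨∅, isOpen_empty, subset_rfl, 0, le_rfl, by simp⟩
  · rintro s t hst ⟨U, hU, htU, hL⟩
    exact ⟨U, hU, hst.trans htU, hL⟩
  · rintro s t ⟨U, hU, hsU, L, hL, h⟩ ⟨U', hU', hsU', L', hL', h'⟩
    refine ⟨U ∪ U', hU.union hU', union_subset_union hsU hsU', max L L', le_max_of_le_left hL, ?_⟩
    rintro a' v hv (hvU | hvU)
    · obtain ⟨b, hb, hvb⟩ := h a' v hv hvU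
      exact ⟨b, hb, hvb.trans (by gcongr; exact le_max_left _ _)⟩
    · obtain ⟨b, hb, hvb⟩ := h' a' v hv hvU
      exact ⟨b, hb, hvb.trans (by gcongr; exact le_max_right _ _)⟩
  · intro b hb
    obtain ⟨U, hU, L, hL, h⟩ := hF b (hKF hb)
    refine ⟨interior U, mem_nhdsWithin_of_mem_nhds (interior_mem_nhds.2 hU), interior U,
      isOpen_interior, subset_rfl, L, hL, fun a' v hv hvU => ?_⟩
    obtain ⟨b', hb', e, he, rfl⟩ := h a' ⟨hv, interior_subset hvU⟩
    exact ⟨b', hb', by simpa using he⟩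

variable {E : Type*} [NormedAddCommGroup E] [InnerProductSpace ℝ E]

theorem ConvexFun.hasConvexityModulus_zero {h : E → EReal} (hc : ConvexFun h) :
    HasConvexityModulus 0 h := by
  simpa [HasConvexityModulus] using hc

/-- The defining inequality of a convexity modulus. -/
theorem HasConvexityModulus.le {h : E → EReal} {c : ℝ} (hc : HasConvexityModulus c h)
    {x x' : E} {r r' : ℝ} (hx : h x ≤ r) (hx' : h x' ≤ r') {t : ℝ} (ht : t ∈ Icc (0 : ℝ) 1) :
    h (x + t • (x' - x)) ≤
      ((1 - t) * r + t * r' - c / 2 * (t * (1 - t)) * ‖x' - x‖ ^ 2 : ℝ) := by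
  have key : ∀ {w : E} {s : ℝ}, h w ≤ s →
      h w - ((c / 2 * ‖w‖ ^ 2 : ℝ) : EReal) ≤ ((s - c / 2 * ‖w‖ ^ 2 : ℝ) : EReal) := by
    intro w s hw
    rw [EReal.coe_sub]
    exact EReal.sub_le_sub hw le_rfl
  have h1 := hc (show (x, r - c / 2 * ‖x‖ ^ 2) ∈ _ from key hx)
    (show (x', r' - c / 2 * ‖x'‖ ^ 2) ∈ _ from key hx')
    (sub_nonneg.2 ht.2) ht.1 (by ring)
  have h2 : h ((1 - t) • x + t • x') - ((c / 2 * ‖(1 - t) • x + t • x'‖ ^ 2 : ℝ) : EReal) ≤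
      (((1 - t) * (r - c / 2 * ‖x‖ ^ 2) + t * (r' - c / 2 * ‖x'‖ ^ 2) : ℝ) : EReal) := h1
  have e : x + t • (x' - x) = (1 - t) • x + t • x' := by module
  rw [EReal.sub_le_iff_le_add (Or.inl (EReal.coe_ne_bot _)) (Or.inl (EReal.coe_ne_top _)),
    ← EReal.coe_add] at h2
  rw [e]
  refine h2.trans (EReal.coe_le_coe_iff.2 (le_of_eq ?_))
  have n1 : ‖(1 - t) • x + t • x'‖ ^ 2 =
      (1 - t) ^ 2 * ‖x‖ ^ 2 + 2 * ((1 - t) * t * inner ℝ x x') + t ^ 2 * ‖x'‖ ^ 2 := by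
    rw [norm_add_sq_real, norm_smul, norm_smul, inner_smul_left, inner_smul_right, mul_pow,
      mul_pow, Real.norm_eq_abs, Real.norm_eq_abs, sq_abs, sq_abs]
    simp only [conj_trivial]; ring
  have n2 : ‖x' - x‖ ^ 2 = ‖x'‖ ^ 2 - 2 * inner ℝ x x' + ‖x‖ ^ 2 := by
    rw [norm_sub_sq_real, real_inner_comm]
  rw [n1, n2]; ring

theorem nonpos_of_forall_le_mul {a b : ℝ} (h : ∀ t : ℝ, 0 < t → t ≤ 1 → a ≤ t * b) : a ≤ 0 := by
  have h1 : Tendsto (fun t : ℝ => t * b) (𝓝[>] 0) (𝓝 (0 * b)) :=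
    ((continuous_id.mul continuous_const).tendsto (0 : ℝ)).mono_left nhdsWithin_le_nhds
  rw [zero_mul] at h1
  refine ge_of_tendsto h1 ?_
  filter_upwards [Ioc_mem_nhdsGT (zero_lt_one (α := ℝ))] with t ht using h t ht.1 ht.2

/-- A proximal subgradient of a function with convexity modulus `c` satisfies the subgradient
inequality with the quadratic term of modulus `c`. -/
theorem HasConvexityModulus.le_of_proximal {h : E → EReal} {c C : ℝ}
    (hc : HasConvexityModulus c h) (hb : ∀ x, h x ≠ ⊥) {v x : E} (hx : x ∈ dom h)
    (hprox : ∀ x' ∈ dom h, (h x).toReal + inner ℝ v (x' - x) ≤ (h x').toReal + C * ‖x' - x‖ ^ 2)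
    {x' : E} (hx' : x' ∈ dom h) :
    (h x).toReal + inner ℝ v (x' - x) + c / 2 * ‖x' - x‖ ^ 2 ≤ (h x').toReal := by
  rw [← sub_nonpos]
  -- At `x + t • (x' - x)` the proximal error is only `C t² ‖x' - x‖²`; dividing by `t` and letting
  -- `t → 0` removes it.
  refine nonpos_of_forall_le_mul (b := (C + c / 2) * ‖x' - x‖ ^ 2) fun t ht ht1 => ?_
  have h1 := hc.le (coe_toReal_of_mem_dom hb hx).ge (coe_toReal_of_mem_dom hb hx').ge ⟨ht.le, ht1⟩
  have hd : x + t • (x' - x) ∈ dom h := h1.trans_lt (EReal.coe_lt_top _)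
  have h2 := hprox _ hd
  rw [← coe_toReal_of_mem_dom hb hd, EReal.coe_le_coe_iff] at h1
  rw [add_sub_cancel_left, inner_smul_right, norm_smul, mul_pow, Real.norm_eq_abs, sq_abs] at h2
  refine le_of_mul_le_mul_left ?_ ht
  nlinarith

theorem IsGammaZero.mem_subdiff_iff {h : E → EReal} (hh : IsGammaZero h) {v x : E} :
    v ∈ subdiff h x ↔
      x ∈ dom h ∧ ∀ x' ∈ dom h, (h x).toReal + inner ℝ v (x' - x) ≤ (h x').toReal := by
  constructor
  · intro hv
    have hx : x ∈ dom h := by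
      obtain ⟨x0, hx0⟩ := hh.nonempty_dom
      have h1 := (hv x0).trans_lt hx0
      refine mem_dom_iff.2 fun h2 => ?_
      simp [h2] at h1
    refine ⟨hx, fun x' hx' => ?_⟩
    have := hv x'
    rw [← coe_toReal_of_mem_dom hh.ne_bot hx, ← coe_toReal_of_mem_dom hh.ne_bot hx'] at this
    exact_mod_cast this
  · rintro ⟨hx, hv⟩ x'
    by_cases hx' : x' ∈ dom h
    · rw [← coe_toReal_of_mem_dom hh.ne_bot hx, ← coe_toReal_of_mem_dom hh.ne_bot hx']
      exact_mod_cast hv x' hx'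
    · rw [not_not.1 (mt mem_dom_iff.2 hx')]
      exact le_top

theorem IsGammaZero.convex_subdiff {h : E → EReal} (hh : IsGammaZero h) (x : E) :
    Convex ℝ (subdiff h x) := by
  intro v hv v' hv' a b ha hb hab
  rw [hh.mem_subdiff_iff] at *
  refine ⟨hv.1, fun x' hx' => ?_⟩
  rw [inner_add_left, inner_smul_left, inner_smul_left]
  have h1 := mul_le_mul_of_nonneg_left (hv.2 x' hx') ha
  have h2 := mul_le_mul_of_nonneg_left (hv'.2 x' hx') hb
  obtain rfl : b = 1 - a := by linarith
  simp only [conj_trivial]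
  linarith

/-- The graph of the subdifferential is closed. -/
theorem IsGammaZero.mem_subdiff_of_tendsto {h : E → EReal} (hh : IsGammaZero h) {ι : Type*}
    {l : Filter ι} [l.NeBot] {v x : ι → E} {v₀ x₀ : E} (hv : Tendsto v l (𝓝 v₀))
    (hx : Tendsto x l (𝓝 x₀)) (hvx : ∀ᶠ i in l, v i ∈ subdiff h (x i)) :
    v₀ ∈ subdiff h x₀ := by
  -- Finiteness of `h x₀` is not yet known, so lower semicontinuity is used through real numbers `a`
  -- below it.
  have key : ∀ x' ∈ dom h, ∀ a : ℝ, (a : EReal) < h x₀ →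
      a + inner ℝ v₀ (x' - x₀) ≤ (h x').toReal := by
    intro x' hx' a ha
    have h1 : Tendsto (fun i => a + inner ℝ (v i) (x' - x i)) l
        (𝓝 (a + inner ℝ v₀ (x' - x₀))) :=
      (hv.inner (hx.const_sub x')).const_add a
    refine le_of_tendsto h1 ?_
    filter_upwards [hx.eventually (hh.lsc x₀ a ha), hvx] with i hi hvi
    obtain ⟨hd, hs⟩ := hh.mem_subdiff_iff.1 hvi
    rw [← coe_toReal_of_mem_dom hh.ne_bot hd, gt_iff_lt, EReal.coe_lt_coe_iff] at hi
    linarith [hs x' hx']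
  rw [hh.mem_subdiff_iff]
  have hx₀ : x₀ ∈ dom h := by
    refine mem_dom_iff.2 fun htop => ?_
    obtain ⟨x', hx'⟩ := hh.nonempty_dom
    -- If `h x₀ = ⊤`, every `a` is allowed; this one yields `h x' + 1 ≤ h x'`.
    have := key x' hx' ((h x').toReal - inner ℝ v₀ (x' - x₀) + 1)
      (by rw [htop]; exact EReal.coe_lt_top _)
    linarith
  refine ⟨hx₀, fun x' hx' => ?_⟩
  refine le_of_forall_pos_le_add fun ε hε => ?_
  have := key x' hx' ((h x₀).toReal - ε)
    ((EReal.coe_lt_coe_iff.2 (sub_lt_self _ hε)).trans_eq (coe_toReal_of_mem_dom hh.ne_bot hx₀))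
  linarith

theorem le_conj {h : E → EReal} (hb : ∀ x, h x ≠ ⊥) {x : E} (hx : x ∈ dom h) (v : E) :
    ((inner ℝ x v - (h x).toReal : ℝ) : EReal) ≤ conj h v := by
  rw [EReal.coe_sub, coe_toReal_of_mem_dom hb hx]
  exact le_iSup (fun x => ((inner ℝ x v : ℝ) : EReal) - h x) x

theorem conj_le {h : E → EReal} (hb : ∀ x, h x ≠ ⊥) {v : E} {r : ℝ}
    (hr : ∀ x ∈ dom h, inner ℝ x v - (h x).toReal ≤ r) : conj h v ≤ r := by
  refine iSup_le fun x => ?_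
  by_cases hx : x ∈ dom h
  · rw [← coe_toReal_of_mem_dom hb hx, ← EReal.coe_sub, EReal.coe_le_coe_iff]
    exact hr x hx
  · rw [not_not.1 (mt mem_dom_iff.2 hx), EReal.sub_top]
    exact bot_le

/-- Near the point `0` of the relative interior of `M`, multiples of points of `M` lie in `M`. -/
theorem exists_smul_mem_of_zero_mem_intrinsicInterior {M : Set E}
    (h : (0 : E) ∈ intrinsicInterior ℝ M) :
    ∃ ρ > 0, ∀ e ∈ M, ∀ t : ℝ, ‖t • e‖ ≤ ρ → t • e ∈ M := by
  obtain ⟨o, ho, ho0⟩ := h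
  obtain ⟨ε, hε, hball⟩ := Metric.mem_nhds_iff.1 (mem_interior_iff_mem_nhds.1 ho)
  refine ⟨ε / 2, half_pos hε, fun e he t ht => ?_⟩
  have h0 : (0 : E) ∈ M := by
    have := interior_subset ho
    rwa [mem_preimage, ho0] at this
  have hmem : t • e ∈ affineSpan ℝ M := by
    have := AffineMap.lineMap_mem t (subset_affineSpan ℝ M h0) (subset_affineSpan ℝ M he)
    simpa [AffineMap.lineMap_apply] using this
  have : (⟨t • e, hmem⟩ : affineSpan ℝ M) ∈ Metric.ball o ε := by
    rw [Metric.mem_ball, Subtype.dist_eq, ho0, dist_zero_right]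
    exact ht.trans_lt (half_lt_self hε)
  exact hball this

/-- A family of vectors that is bounded above in all directions close to `0` is bounded. -/
theorem exists_norm_le_of_inner_le [CompleteSpace E] {ι : Type*} (q : ι → E) {N : Set E}
    (hN : N ∈ 𝓝 (0 : E)) (h : ∀ u ∈ N, ∃ c : ℝ, ∀ i, inner ℝ (q i) u ≤ c) :
    ∃ R : ℝ, 0 ≤ R ∧ ∀ i, ‖q i‖ ≤ R := by
  have h1 : ∀ u : E, ∃ c : ℝ, ∀ i, inner ℝ (q i) u ≤ c := by
    intro u
    have ht : Tendsto (fun t : ℝ => t • u) (𝓝[>] 0) (𝓝 ((0 : ℝ) • u)) :=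
      ((continuous_id.smul continuous_const).tendsto (0 : ℝ)).mono_left nhdsWithin_le_nhds
    rw [zero_smul] at ht
    obtain ⟨t, htN, ht0⟩ := ((ht.eventually hN).and self_mem_nhdsWithin).exists
    obtain ⟨c, hc⟩ := h _ htN
    refine ⟨c / t, fun i => ?_⟩
    have := hc i
    rw [inner_smul_right] at this
    rwa [le_div_iff₀' ht0]
  -- Upper bounds at `u` and `-u` give pointwise boundedness, so uniform boundedness applies.
  obtain ⟨R, hR⟩ := banach_steinhaus (g := fun i => innerSL ℝ (q i)) fun u => by
    obtain ⟨c, hc⟩ := h1 u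
    obtain ⟨c', hc'⟩ := h1 (-u)
    refine ⟨max c c', fun i => ?_⟩
    rw [innerSL_apply_apply, Real.norm_eq_abs, abs_le]
    have h2 := hc i
    have h3 := hc' i
    rw [inner_neg_right] at h3
    exact ⟨by linarith [le_max_right c c'], h2.trans (le_max_left _ _)⟩
  refine ⟨max R 0, le_max_right _ _, fun i => ?_⟩
  have := hR i
  rw [innerSL_apply_norm] at this
  exact this.trans (le_max_left _ _)

/-- A bounded sequence all of whose cluster points lie in an open set is eventually in that set. -/
theorem eventually_mem_of_clusterPt [FiniteDimensional ℝ E] {u : ℕ → E} {R : ℝ}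
    (hu : ∀ᶠ k in atTop, ‖u k‖ ≤ R) {U : Set E} (hU : IsOpen U)
    (h : ∀ a, MapClusterPt a atTop u → a ∈ U) : ∀ᶠ k in atTop, u k ∈ U := by
  have : ProperSpace E := FiniteDimensional.proper ℝ E
  by_contra hne
  have hK : IsCompact (Metric.closedBall (0 : E) R \ U) := (isCompact_closedBall 0 R).diff hU
  obtain ⟨a, ha, hcl⟩ := hK.exists_mapClusterPt_of_frequently (l := atTop) (f := u)
    (((not_eventually.1 hne).and_eventually hu).mono fun k hk => ⟨by simpa using hk.2, hk.1⟩)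
  exact ha.2 (h a hcl)

end Subgradients

end NAMA

namespace NAMA

/-! ### Multipliers: chain rule and linear regularity -/

section Duality

variable {X Y : Type*} [NormedAddCommGroup X] [InnerProductSpace ℝ X]
  [NormedAddCommGroup Y] [InnerProductSpace ℝ Y]

/-- A convex epigraph-like set whose projection is a neighborhood of `0` has an affine minorant
that is exact at `0`. -/
theorem exists_affine_minorant [FiniteDimensional ℝ Y] {D : Set (Y × ℝ)} (hD : Convex ℝ D)
    (hup : ∀ u t t', (u, t) ∈ D → t ≤ t' → (u, t') ∈ D) {N : Set Y} (hN : N ∈ 𝓝 (0 : Y))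
    (hND : ∀ u ∈ N, ∃ t, (u, t) ∈ D) {p : ℝ} (hp : ∀ t, ((0 : Y), t) ∈ D → p ≤ t) :
    ∃ q : Y, ∀ u t, (u, t) ∈ D → p + inner ℝ q u ≤ t := by
  have hscale : ∀ u : Y, ∃ t : ℝ, 0 < t ∧ t • u ∈ N := by
    intro u
    have ht : Tendsto (fun t : ℝ => t • u) (𝓝[>] 0) (𝓝 ((0 : ℝ) • u)) :=
      ((continuous_id.smul continuous_const).tendsto (0 : ℝ)).mono_left nhdsWithin_le_nhds
    rw [zero_smul] at ht
    obtain ⟨t, htN, ht0⟩ := ((ht.eventually hN).and self_mem_nhdsWithin).exists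
    exact ⟨t, ht0, htN⟩
  obtain ⟨t₀, ht₀⟩ := hND 0 (mem_of_mem_nhds hN)
  -- Upward closedness gives the vertical direction, `hND` the others. Being convex in finite
  -- dimension, `D` then has interior points and `(0, p)` can be separated from it.
  have hspan : affineSpan ℝ D = ⊤ := by
    rw [← AffineSubspace.direction_eq_top_iff_of_nonempty ⟨_, subset_affineSpan ℝ D ht₀⟩,
      eq_top_iff]
    rintro ⟨u, r⟩ -
    have hv : ((0 : Y), (1 : ℝ)) ∈ (affineSpan ℝ D).direction := by
      have := AffineSubspace.vsub_mem_direction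
        (subset_affineSpan ℝ D (hup _ _ (t₀ + 1) ht₀ (by linarith))) (subset_affineSpan ℝ D ht₀)
      simpa using this
    obtain ⟨t, ht, htu⟩ := hscale u
    obtain ⟨T, hT⟩ := hND _ htu
    have hh : (t • u, T - t₀) ∈ (affineSpan ℝ D).direction := by
      have := AffineSubspace.vsub_mem_direction
        (subset_affineSpan ℝ D hT) (subset_affineSpan ℝ D ht₀)
      simpa using this
    have := Submodule.add_mem _ (Submodule.smul_mem _ t⁻¹ hh)
      (Submodule.smul_mem _ (r - t⁻¹ * (T - t₀)) hv)
    simpa [smul_smul, ht.ne'] using this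
  have hpi : ((0 : Y), p) ∉ interior D := by
    intro h
    have ht : Tendsto (fun t : ℝ => ((0 : Y), p - t)) (𝓝[>] 0) (𝓝 ((0 : Y), p - 0)) := by
      refine Tendsto.mono_left (Continuous.tendsto ?_ (0 : ℝ)) nhdsWithin_le_nhds
      fun_prop
    rw [sub_zero] at ht
    obtain ⟨t, htD, ht0⟩ := ((ht.eventually (mem_interior_iff_mem_nhds.1 h)).and
      self_mem_nhdsWithin).exists
    have := hp _ htD
    have ht0 : 0 < t := ht0
    linarith
  obtain ⟨φ, hφ0, hφ⟩ := geometric_hahn_banach_of_nonempty_interior_point hD hpi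
    (hD.interior_nonempty_iff_affineSpan_eq_top.2 hspan)
  set q₀ : Y := (InnerProductSpace.toDual ℝ Y).symm (φ.comp (ContinuousLinearMap.inl ℝ Y ℝ))
  set s : ℝ := φ (0, 1)
  have hφe : ∀ u t, φ (u, t) = inner ℝ q₀ u + s * t := by
    intro u t
    have h1 : inner ℝ q₀ u = φ (u, 0) := by
      simp [q₀]
    have h2 : (u, t) = (u, (0 : ℝ)) + t • ((0 : Y), (1 : ℝ)) := by simp
    rw [h2, map_add, map_smul, h1, smul_eq_mul, mul_comm]
  have hle : ∀ u t, (u, t) ∈ D → inner ℝ q₀ u + s * t ≤ s * p := by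
    intro u t h
    have := hφ _ h
    rwa [hφe, hφe, inner_zero_right, zero_add] at this
  -- The separating hyperplane is not vertical: `s > 0` fails for large `t`, and `s = 0` would force
  -- `q₀ = 0` because `D` projects onto a neighborhood of `0`.
  have hs : s < 0 := by
    refine lt_of_le_of_ne ?_ fun hs => ?_
    · by_contra! hs
      have := hle 0 _ (hup _ _ (max t₀ p + 1) ht₀ (by linarith [le_max_left t₀ p]))
      rw [inner_zero_right, zero_add] at this
      have := le_of_mul_le_mul_left this hs
      linarith [le_max_right t₀ p]
    · have h0 : q₀ = 0 := by
        obtain ⟨t, ht, htu⟩ := hscale q₀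
        obtain ⟨T, hT⟩ := hND _ htu
        have := hle _ _ hT
        rw [hs, zero_mul, zero_mul, add_zero, inner_smul_right] at this
        exact real_inner_self_nonpos.1 (nonpos_of_mul_nonpos_right this ht)
      refine hφ0 (ContinuousLinearMap.ext fun ⟨u, t⟩ => ?_)
      rw [hφe, h0, hs]; simp
  refine ⟨(-s)⁻¹ • q₀, fun u t h => ?_⟩
  have h1 := hle u t h
  have h2 : (-s)⁻¹ * (-s) = 1 := inv_mul_cancel₀ (by linarith)
  have h3 : 0 < (-s)⁻¹ := inv_pos.2 (by linarith)
  rw [inner_smul_left, conj_trivial]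
  have h4 := mul_le_mul_of_nonneg_left h1 h3.le
  linear_combination h4 + (t - p) * h2

variable {f : X → EReal} {g : Y → EReal} {A : X →L[ℝ] Y}

theorem mem_dom_of_isMinOn_primal {xs : X} (hf : IsGammaZero f) (hg : IsGammaZero g)
    (hfeas : (A '' dom f ∩ dom g).Nonempty) (hxs : IsMinOn (primal f g A) univ xs) :
    xs ∈ dom f ∧ A xs ∈ dom g := by
  obtain ⟨_, ⟨x, hx, rfl⟩, hAx⟩ := hfeas
  have h1 : primal f g A xs ≤ primal f g A x := hxs (mem_univ x)
  have h2 : primal f g A xs < ⊤ := h1.trans_lt (EReal.add_lt_top hx.ne hAx.ne)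
  rw [primal] at h2
  constructor
  · refine mem_dom_iff.2 fun h => ?_
    rw [h, EReal.top_add_of_ne_bot (hg.ne_bot _)] at h2
    exact lt_irrefl _ h2
  · refine mem_dom_iff.2 fun h => ?_
    rw [h, EReal.add_top_of_ne_bot (hf.ne_bot _)] at h2
    exact lt_irrefl _ h2

variable [FiniteDimensional ℝ X] [FiniteDimensional ℝ Y]

/-- The dual solutions associated with the primal solution `xs`. -/
def multipliers (f : X → EReal) (g : Y → EReal) (A : X →L[ℝ] Y) (xs : X) : Set Y :=
  {q | q ∈ subdiff g (A xs) ∧ -(LinearMap.adjoint (A : X →ₗ[ℝ] Y) q) ∈ subdiff f xs}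

theorem inner_adjoint_left (A : X →L[ℝ] Y) (q : Y) (x : X) :
    inner ℝ (LinearMap.adjoint (A : X →ₗ[ℝ] Y) q) x = inner ℝ q (A x) := by
  rw [LinearMap.adjoint_inner_left]; rfl

theorem norm_adjoint_le (A : X →L[ℝ] Y) (q : Y) :
    ‖LinearMap.adjoint (A : X →ₗ[ℝ] Y) q‖ ≤ ‖A‖ * ‖q‖ := by
  set v := LinearMap.adjoint (A : X →ₗ[ℝ] Y) q with hv
  rcases eq_or_ne v 0 with h | h
  · rw [h, norm_zero]; positivity
  · have h1 : ‖v‖ * ‖v‖ ≤ ‖A‖ * ‖q‖ * ‖v‖ := by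
      rw [← real_inner_self_eq_norm_mul_norm]
      calc inner ℝ v v = inner ℝ q (A v) := inner_adjoint_left A q v
        _ ≤ ‖q‖ * ‖A v‖ := real_inner_le_norm _ _
        _ ≤ ‖q‖ * (‖A‖ * ‖v‖) := by gcongr; exact A.le_opNorm v
        _ = _ := by ring
    exact le_of_mul_le_mul_right h1 (norm_pos_iff.2 h)

/-- Sum and chain rule for the subdifferential of `f + g ∘ A`. -/
theorem exists_mem_subdiff_of_mem_subdiff_primal (hf : IsGammaZero f) (hg : IsGammaZero g)
    (hstrong : (0 : Y) ∈ interior (dom g - A '' dom f)) {xs v : X} (hxf : xs ∈ dom f)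
    (hxg : A xs ∈ dom g) (hv : v ∈ subdiff (primal f g A) xs) :
    ∃ q ∈ subdiff g (A xs), v - LinearMap.adjoint (A : X →ₗ[ℝ] Y) q ∈ subdiff f xs := by
  have hmin : ∀ x ∈ dom f, A x ∈ dom g →
      (f xs).toReal + (g (A xs)).toReal ≤
        (f x).toReal + (g (A x)).toReal - inner ℝ v (x - xs) := by
    intro x hx hAx
    have := hv x
    rw [primal, primal, ← coe_toReal_of_mem_dom hf.ne_bot hx,
      ← coe_toReal_of_mem_dom hf.ne_bot hxf, ← coe_toReal_of_mem_dom hg.ne_bot hAx,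
      ← coe_toReal_of_mem_dom hg.ne_bot hxg] at this
    have : (f xs).toReal + (g (A xs)).toReal + inner ℝ v (x - xs) ≤
        (f x).toReal + (g (A x)).toReal := by exact_mod_cast this
    linarith
  -- Epigraph-like set of the perturbation function `u ↦ inf {f x + g z - ⟨v, x - xs⟩ | z - A x =
  -- u}`. The slope of an affine minorant exact at `0` is the required `q`.
  let D : Set (Y × ℝ) := {d | ∃ x ∈ dom f, ∃ z ∈ dom g, z - A x = d.1 ∧
    (f x).toReal + (g z).toReal - inner ℝ v (x - xs) ≤ d.2}
  have hD : Convex ℝ D := by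
    rintro d ⟨x, hx, z, hz, hu, hr⟩ d' ⟨x', hx', z', hz', hu', hr'⟩ a b ha hb hab
    obtain rfl : a = 1 - b := by linarith
    have hb' : b ∈ Icc (0 : ℝ) 1 := ⟨hb, by linarith⟩
    have h1 := hf.convex.hasConvexityModulus_zero.le (coe_toReal_of_mem_dom hf.ne_bot hx).ge
      (coe_toReal_of_mem_dom hf.ne_bot hx').ge hb'
    have h2 := hg.convex.hasConvexityModulus_zero.le (coe_toReal_of_mem_dom hg.ne_bot hz).ge
      (coe_toReal_of_mem_dom hg.ne_bot hz').ge hb'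
    have d1 : x + b • (x' - x) ∈ dom f := h1.trans_lt (EReal.coe_lt_top _)
    have d2 : z + b • (z' - z) ∈ dom g := h2.trans_lt (EReal.coe_lt_top _)
    rw [← coe_toReal_of_mem_dom hf.ne_bot d1, EReal.coe_le_coe_iff] at h1
    rw [← coe_toReal_of_mem_dom hg.ne_bot d2, EReal.coe_le_coe_iff] at h2
    refine ⟨_, d1, _, d2, ?_, ?_⟩
    · simp only [Prod.fst_add, Prod.smul_fst, ← hu, ← hu', map_add, map_smul, map_sub]
      module
    · simp only [Prod.snd_add, Prod.smul_snd, smul_eq_mul]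
      have e : x + b • (x' - x) - xs = (1 - b) • (x - xs) + b • (x' - xs) := by module
      rw [e, inner_add_right, inner_smul_right, inner_smul_right]
      have h3 := mul_le_mul_of_nonneg_left hr ha
      have h4 := mul_le_mul_of_nonneg_left hr' hb
      linarith
  obtain ⟨q, hq⟩ := exists_affine_minorant hD
    (fun u t t' ⟨x, hx, z, hz, hu, hr⟩ htt => ⟨x, hx, z, hz, hu, hr.trans htt⟩)
    (mem_interior_iff_mem_nhds.1 hstrong)
    (by
      rintro _ ⟨z, hz, _, ⟨x, hx, rfl⟩, rfl⟩
      exact ⟨_, x, hx, z, hz, rfl, le_rfl⟩)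
    (p := (f xs).toReal + (g (A xs)).toReal)
    (by
      rintro t ⟨x, hx, z, hz, hu, hr⟩
      obtain rfl : z = A x := sub_eq_zero.1 hu
      exact (hmin x hx hz).trans hr)
  have key : ∀ x ∈ dom f, ∀ z ∈ dom g, (f xs).toReal + (g (A xs)).toReal + inner ℝ q (z - A x) ≤
      (f x).toReal + (g z).toReal - inner ℝ v (x - xs) :=
    fun x hx z hz => hq _ _ ⟨x, hx, z, hz, rfl, le_rfl⟩
  refine ⟨q, hg.mem_subdiff_iff.2 ⟨hxg, fun z hz => ?_⟩,
    hf.mem_subdiff_iff.2 ⟨hxf, fun x hx => ?_⟩⟩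
  · have := key xs hxf z hz
    rw [sub_self, inner_zero_right] at this
    linarith
  · have := key x hx _ hxg
    rw [inner_sub_left, inner_adjoint_left, map_sub, ← neg_sub (A xs), inner_neg_right]
    linarith

/-- Bounded linear regularity of the two sets whose intersection is the set of multipliers, under
strict complementarity. -/
theorem exists_multiplier_norm_sub_le (hf : IsGammaZero f) (hg : IsGammaZero g)
    (hstrong : (0 : Y) ∈ interior (dom g - A '' dom f)) {xs : X} (hxf : xs ∈ dom f)
    (hxg : A xs ∈ dom g) (hstrict : (0 : X) ∈ intrinsicInterior ℝ (subdiff (primal f g A) xs))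
    (R : ℝ) :
    ∃ κ : ℝ, 0 ≤ κ ∧ ∀ q ∈ subdiff g (A xs), ‖q‖ ≤ R → ∀ p ∈ subdiff f xs,
      ∃ q' ∈ multipliers f g A xs,
        ‖q - q'‖ ≤ κ * ‖p + LinearMap.adjoint (A : X →ₗ[ℝ] Y) q‖ := by
  obtain ⟨ρ, hρ, hM⟩ := exists_smul_mem_of_zero_mem_intrinsicInterior hstrict
  -- The decompositions of all `v` with `‖v‖ ≤ ρ` have uniformly bounded `q`, by the interior
  -- condition.
  obtain ⟨R', hR'0, hR'⟩ := exists_norm_le_of_inner_le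
    (ι := {vq : X × Y // ‖vq.1‖ ≤ ρ ∧ vq.2 ∈ subdiff g (A xs) ∧
      vq.1 - LinearMap.adjoint (A : X →ₗ[ℝ] Y) vq.2 ∈ subdiff f xs}) (fun i => i.1.2)
    (mem_interior_iff_mem_nhds.1 hstrong) (by
      rintro _ ⟨z, hz, _, ⟨x, hx, rfl⟩, rfl⟩
      refine ⟨(f x).toReal + (g z).toReal - (f xs).toReal - (g (A xs)).toReal + ρ * ‖x - xs‖, ?_⟩
      rintro ⟨⟨v, q⟩, hv, hq, hp⟩
      have h1 := (hg.mem_subdiff_iff.1 hq).2 z hz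
      have h2 := (hf.mem_subdiff_iff.1 hp).2 x hx
      have h3 : -(ρ * ‖x - xs‖) ≤ inner ℝ v (x - xs) := by
        have h4 := (abs_le.1 (abs_real_inner_le_norm v (x - xs))).1
        have h5 : ‖v‖ * ‖x - xs‖ ≤ ρ * ‖x - xs‖ := by gcongr
        linarith
      rw [inner_sub_left, inner_adjoint_left, map_sub, inner_sub_right q] at h2
      rw [inner_sub_right] at h1 ⊢
      dsimp only
      linarith)
  refine ⟨(|R| + R') / ρ, by positivity, fun q hq hqR p hp => ?_⟩
  set B := LinearMap.adjoint (A : X →ₗ[ℝ] Y)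
  set e := p + B q with he
  rcases eq_or_ne e 0 with h0 | h0
  · refine ⟨q, ⟨hq, ?_⟩, by rw [sub_self, norm_zero, h0, norm_zero, mul_zero]⟩
    rwa [← eq_neg_of_add_eq_zero_left (he.symm.trans h0)]
  have hδ : 0 < ‖e‖ := norm_pos_iff.2 h0
  have heM : e ∈ subdiff (primal f g A) xs := by
    intro x'
    have h1 := hp x'
    have h2 := hq (A x')
    rw [← map_sub, ← inner_adjoint_left] at h2
    refine le_trans (le_of_eq ?_) (add_le_add h1 h2)
    rw [he, inner_add_left, primal, EReal.coe_add]
    abel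
  have hn : ‖(-(ρ / ‖e‖)) • e‖ = ρ := by
    rw [norm_smul, norm_neg, Real.norm_eq_abs, abs_of_pos (by positivity)]
    field_simp
  -- Strict complementarity admits the opposite multiple of `e`, of norm `ρ`; the chain rule
  -- decomposes it.
  obtain ⟨q', hq', hp'⟩ := exists_mem_subdiff_of_mem_subdiff_primal hf hg hstrong hxf hxg
    (hM e heM (-(ρ / ‖e‖)) hn.le)
  have hq'R : ‖q'‖ ≤ R' := hR' ⟨(_, q'), hn.le, hq', hp'⟩
  -- These convex weights make `e` and `-(ρ / ‖e‖) • e` cancel, so the combination of `q` and `q'`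
  -- is a multiplier. The weight of `q'` is at most `‖e‖ / ρ`.
  have ha : 0 ≤ ρ / (ρ + ‖e‖) := by positivity
  have hb : 0 ≤ ‖e‖ / (ρ + ‖e‖) := by positivity
  have hab : ρ / (ρ + ‖e‖) + ‖e‖ / (ρ + ‖e‖) = 1 := by field_simp
  refine ⟨(ρ / (ρ + ‖e‖)) • q + (‖e‖ / (ρ + ‖e‖)) • q',
    ⟨hg.convex_subdiff _ hq hq' ha hb hab, ?_⟩, ?_⟩
  · have := hf.convex_subdiff _ hp hp' ha hb hab
    convert this using 1
    have e1 : p = e - B q := by rw [he]; abel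
    have e2 : (‖e‖ / (ρ + ‖e‖)) * (-(ρ / ‖e‖)) = -(ρ / (ρ + ‖e‖)) := by field_simp
    rw [e1, smul_sub, smul_sub, smul_smul, e2, map_add, map_smul, map_smul]
    module
  · have e1 : q - ((ρ / (ρ + ‖e‖)) • q + (‖e‖ / (ρ + ‖e‖)) • q') =
        (‖e‖ / (ρ + ‖e‖)) • (q - q') := by
      have : ρ / (ρ + ‖e‖) = 1 - ‖e‖ / (ρ + ‖e‖) := by linarith
      rw [this]; module
    rw [e1, norm_smul, Real.norm_of_nonneg hb]
    have h1 : ‖q - q'‖ ≤ |R| + R' :=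
      (norm_sub_le _ _).trans (add_le_add (hqR.trans (le_abs_self R)) hq'R)
    calc ‖e‖ / (ρ + ‖e‖) * ‖q - q'‖ ≤ ‖e‖ / ρ * (|R| + R') := by
          gcongr; linarith
      _ = (|R| + R') / ρ * ‖e‖ := by ring

end Duality

end NAMA

namespace NAMA

/-! ### Estimates for one iteration -/

section Iteration

variable {X Y : Type*} [NormedAddCommGroup X] [InnerProductSpace ℝ X]
  [NormedAddCommGroup Y] [InnerProductSpace ℝ Y]
  {f : X → EReal} {g : Y → EReal} {A : X →L[ℝ] Y} {γ μ : ℝ} {x xs : X} {y z : Y}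

/-- Optimality conditions of the alternating minimization, in terms of real values. -/
structure OptCond (f : X → EReal) (g : Y → EReal) (A : X →L[ℝ] Y) (γ μ : ℝ) (y : Y) (x : X)
    (z : Y) : Prop where
  mem_f : x ∈ dom f
  mem_g : z ∈ dom g
  le_f : ∀ x' ∈ dom f,
    (f x).toReal - inner ℝ y (A (x' - x)) + μ / 2 * ‖x' - x‖ ^ 2 ≤ (f x').toReal
  le_g : ∀ z' ∈ dom g,
    (g z).toReal + inner ℝ (y + γ • (A x - z)) (z' - z) ≤ (g z').toReal

/-- Real value of the augmented Lagrangian. -/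
noncomputable def lag (f : X → EReal) (g : Y → EReal) (A : X →L[ℝ] Y) (γ : ℝ) (x : X) (z y : Y) :
    ℝ :=
  (f x).toReal + (g z).toReal + (inner ℝ y (A x - z) + γ / 2 * ‖A x - z‖ ^ 2)

theorem augLag_eq (hf : IsGammaZero f) (hg : IsGammaZero g) (hx : x ∈ dom f) (hz : z ∈ dom g) :
    augLag f g A γ x z y = (lag f g A γ x z y : EReal) := by
  rw [lag, EReal.coe_add, EReal.coe_add (f x).toReal, coe_toReal_of_mem_dom hf.ne_bot hx,
    coe_toReal_of_mem_dom hg.ne_bot hz, augLag]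

theorem AltMin.optCond [FiniteDimensional ℝ X] [FiniteDimensional ℝ Y]
    (hf : IsGammaZero f) (hg : IsGammaZero g)
    (hfμ : HasConvexityModulus μ f) (h : AltMin f g A γ y x z) : OptCond f g A γ μ y x z := by
  obtain ⟨h1, h2⟩ := h
  have h1 : ∀ x', f x + ((inner ℝ y (A x) : ℝ) : EReal) ≤ f x' + ((inner ℝ y (A x') : ℝ) : EReal) :=
    fun x' => h1 (mem_univ x')
  have h2 : ∀ z', augLag f g A γ x z y ≤ augLag f g A γ x z' y := fun z' => h2 (mem_univ z')
  have hx : x ∈ dom f := by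
    obtain ⟨x', hx'⟩ := hf.nonempty_dom
    refine mem_dom_iff.2 fun htop => ?_
    have := h1 x'
    rw [htop, EReal.top_add_coe, ← coe_toReal_of_mem_dom hf.ne_bot hx', ← EReal.coe_add,
      top_le_iff] at this
    exact EReal.coe_ne_top _ this
  have hz : z ∈ dom g := by
    obtain ⟨z', hz'⟩ := hg.nonempty_dom
    refine mem_dom_iff.2 fun htop => ?_
    have := h2 z'
    rw [augLag_eq hf hg hx hz', augLag, htop, ← coe_toReal_of_mem_dom hf.ne_bot hx,
      EReal.coe_add_top, EReal.top_add_coe, top_le_iff] at this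
    exact EReal.coe_ne_top _ this
  refine ⟨hx, hz, fun x' hx' => ?_, fun z' hz' => ?_⟩
  · have := hfμ.le_of_proximal hf.ne_bot (C := 0)
      (v := -(LinearMap.adjoint (A : X →ₗ[ℝ] Y) y)) hx (fun x' hx' => ?_) hx'
    · rwa [inner_neg_left, inner_adjoint_left, ← sub_eq_add_neg] at this
    · have := h1 x'
      rw [← coe_toReal_of_mem_dom hf.ne_bot hx, ← coe_toReal_of_mem_dom hf.ne_bot hx',
        ← EReal.coe_add, ← EReal.coe_add, EReal.coe_le_coe_iff] at this
      rw [inner_neg_left, inner_adjoint_left, map_sub, inner_sub_right]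
      linarith
  -- The penalty term makes minimality in `z` a proximal inequality with `C = γ / 2`; convexity
  -- upgrades it to a true subgradient inequality.
  · have := hg.convex.hasConvexityModulus_zero.le_of_proximal hg.ne_bot (C := γ / 2)
      (v := y + γ • (A x - z)) hz (fun z' hz' => ?_) hz'
    · linarith
    · have := h2 z'
      rw [augLag_eq hf hg hx hz, augLag_eq hf hg hx hz', EReal.coe_le_coe_iff, lag, lag] at this
      have e : A x - z' = (A x - z) - (z' - z) := by abel
      set s := A x - z
      rw [e, norm_sub_sq_real s, inner_sub_right y s] at this
      rw [inner_add_left, inner_smul_left, conj_trivial]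
      linarith

namespace OptCond

theorem mem_subdiff_g (hg : IsGammaZero g) (h : OptCond f g A γ μ y x z) :
    y + γ • (A x - z) ∈ subdiff g z :=
  hg.mem_subdiff_iff.2 ⟨h.mem_g, h.le_g⟩

variable [FiniteDimensional ℝ X] [FiniteDimensional ℝ Y]

theorem mem_subdiff_f (hf : IsGammaZero f) (hμ : 0 ≤ μ) (h : OptCond f g A γ μ y x z) :
    -(LinearMap.adjoint (A : X →ₗ[ℝ] Y) y) ∈ subdiff f x := by
  refine hf.mem_subdiff_iff.2 ⟨h.mem_f, fun x' hx' => ?_⟩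
  have := h.le_f x' hx'
  have h1 : 0 ≤ μ / 2 * ‖x' - x‖ ^ 2 := by positivity
  rw [inner_neg_left, inner_adjoint_left]
  linarith

end OptCond

variable [FiniteDimensional ℝ X] [FiniteDimensional ℝ Y]

/-- Weak duality, by Fenchel–Young for `f` and `g`. Leaving `z` independent of `A x` serves both the
boundedness of sublevel sets and the residual estimate. -/
theorem le_dual (hf : IsGammaZero f) (hg : IsGammaZero g) (hx : x ∈ dom f) (hz : z ∈ dom g)
    (y : Y) :
    ((inner ℝ y (z - A x) - (f x).toReal - (g z).toReal : ℝ) : EReal) ≤ dual f g A y := by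
  refine le_trans (le_of_eq ?_) (add_le_add
    (le_conj hf.ne_bot hx (-(LinearMap.adjoint (A : X →ₗ[ℝ] Y) y))) (le_conj hg.ne_bot hz y))
  rw [← EReal.coe_add, EReal.coe_eq_coe_iff, inner_neg_right, real_inner_comm _ x,
    inner_adjoint_left, real_inner_comm y z, inner_sub_right]
  ring

theorem dual_le (hf : IsGammaZero f) (hg : IsGammaZero g) {r r' : ℝ}
    (hr : ∀ x ∈ dom f, -inner ℝ y (A x) - (f x).toReal ≤ r)
    (hr' : ∀ z ∈ dom g, inner ℝ y z - (g z).toReal ≤ r') :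
    dual f g A y ≤ ((r + r' : ℝ) : EReal) := by
  rw [EReal.coe_add]
  refine add_le_add (conj_le hf.ne_bot fun x hx => ?_) (conj_le hg.ne_bot fun z hz => ?_)
  · rw [inner_neg_right, real_inner_comm, inner_adjoint_left]
    exact hr x hx
  · rw [real_inner_comm]
    exact hr' z hz

/-- Dual sublevel sets are bounded. -/
theorem exists_norm_le_of_dual_le (hf : IsGammaZero f) (hg : IsGammaZero g)
    (hstrong : (0 : Y) ∈ interior (dom g - A '' dom f)) (r : ℝ) :
    ∃ R : ℝ, 0 ≤ R ∧ ∀ y, dual f g A y ≤ r → ‖y‖ ≤ R := by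
  obtain ⟨R, hR0, hR⟩ := exists_norm_le_of_inner_le (fun i : {y // dual f g A y ≤ r} => i.1)
    (mem_interior_iff_mem_nhds.1 hstrong) (by
      rintro _ ⟨z, hz, _, ⟨x, hx, rfl⟩, rfl⟩
      refine ⟨r + (f x).toReal + (g z).toReal, fun ⟨y, hy⟩ => ?_⟩
      have := (le_dual hf hg hx hz y).trans hy
      rw [EReal.coe_le_coe_iff] at this
      dsimp only
      linarith)
  exact ⟨R, hR0, fun y hy => hR ⟨y, hy⟩⟩

theorem dual_le_of_mem_multipliers (hf : IsGammaZero f) (hg : IsGammaZero g)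
    (hy : y ∈ multipliers f g A xs) :
    dual f g A y ≤ ((-((f xs).toReal + (g (A xs)).toReal) : ℝ) : EReal) := by
  obtain ⟨hxg, h1⟩ := hg.mem_subdiff_iff.1 hy.1
  obtain ⟨hxf, h2⟩ := hf.mem_subdiff_iff.1 hy.2
  refine (dual_le hf hg (r := -inner ℝ y (A xs) - (f xs).toReal)
    (r' := inner ℝ y (A xs) - (g (A xs)).toReal) (fun x hx => ?_) fun z hz => ?_).trans
    (EReal.coe_le_coe_iff.2 (by linarith))
  · have := h2 x hx
    rw [inner_neg_left, inner_adjoint_left, map_sub, inner_sub_right] at this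
    linarith
  · have := h1 z hz
    rw [inner_sub_right] at this
    linarith

namespace OptCond

/-- The alternating minimization step decreases the dual objective below the negative of the
augmented Lagrangian. -/
theorem dual_add_le (hf : IsGammaZero f) (hg : IsGammaZero g) (hγ : 0 < γ)
    (hγ' : γ * ‖A‖ ^ 2 ≤ μ) (h : OptCond f g A γ μ y x z) :
    dual f g A (y + γ • (A x - z)) ≤ ((-lag f g A γ x z y : ℝ) : EReal) := by
  set s := A x - z with hs
  set w := y + γ • s with hw
  -- The term `γ / 2 * ‖s‖ ^ 2` is the price of moving the dual point from `y` to `w`: with `d = ‖x'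
  -- - x‖`, `γ‖s‖‖A‖d - μ/2 d² ≤ γ/2 ‖s‖²` since `γ‖A‖² ≤ μ`.
  refine (dual_le hf hg (r := -(f x).toReal - inner ℝ w (A x) + γ / 2 * ‖s‖ ^ 2)
    (r' := inner ℝ w z - (g z).toReal) (fun x' hx' => ?_) fun z' hz' => ?_).trans
    (EReal.coe_le_coe_iff.2 ?_)
  · have h1 := h.le_f x' hx'
    have h2 : -(γ * (‖s‖ * (‖A‖ * ‖x' - x‖))) ≤ γ * inner ℝ s (A (x' - x)) := by
      rw [← mul_neg]
      gcongr
      have h3 := (abs_le.1 (abs_real_inner_le_norm s (A (x' - x)))).1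
      have h4 : ‖s‖ * ‖A (x' - x)‖ ≤ ‖s‖ * (‖A‖ * ‖x' - x‖) := by
        gcongr; exact A.le_opNorm _
      linarith
    have h5 : γ * ‖A‖ ^ 2 * ‖x' - x‖ ^ 2 ≤ μ * ‖x' - x‖ ^ 2 := by gcongr
    have h6 : 0 ≤ γ * (‖s‖ - ‖A‖ * ‖x' - x‖) ^ 2 := by positivity
    have e1 : inner ℝ w (A x') = inner ℝ w (A x) + inner ℝ w (A (x' - x)) := by
      rw [map_sub, inner_sub_right]; ring
    have e2 : inner ℝ w (A (x' - x)) = inner ℝ y (A (x' - x)) + γ * inner ℝ s (A (x' - x)) := by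
      rw [hw, inner_add_left, inner_smul_left, conj_trivial]
    rw [e1, e2]
    nlinarith
  · have := h.le_g z' hz'
    rw [inner_sub_right] at this
    linarith
  · have e1 : inner ℝ w (A x) - inner ℝ w z = inner ℝ y s + γ * ‖s‖ ^ 2 := by
      rw [← inner_sub_right, ← hs, hw, inner_add_left, inner_smul_left, conj_trivial,
        real_inner_self_eq_norm_sq]
    rw [lag, ← hs]
    linarith

theorem lag_le_dual (hf : IsGammaZero f) (hg : IsGammaZero g) (h : OptCond f g A γ μ y x z) :
    ((-lag f g A γ x z y + γ / 2 * ‖A x - z‖ ^ 2 : ℝ) : EReal) ≤ dual f g A y := by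
  refine le_trans (EReal.coe_le_coe_iff.2 (le_of_eq ?_)) (le_dual hf hg h.mem_f h.mem_g y)
  rw [lag, ← neg_sub (A x) z, inner_neg_right]
  ring

/-- Weak duality at the mixed pair `(x, A xs)`, with strong convexity between `x` and `xs`; it turns
the dual rate into a rate for `x`. -/
theorem sq_norm_sub_le_dual (hf : IsGammaZero f) (hg : IsGammaZero g)
    (h : OptCond f g A γ μ y x z) (hxf : xs ∈ dom f) (hxg : A xs ∈ dom g) :
    ((-((f xs).toReal + (g (A xs)).toReal) + μ / 2 * ‖x - xs‖ ^ 2 : ℝ) : EReal) ≤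
      dual f g A y := by
  refine le_trans (EReal.coe_le_coe_iff.2 ?_) (le_dual hf hg h.mem_f hxg y)
  have := h.le_f xs hxf
  rw [map_sub, norm_sub_rev] at this
  linarith

/-- Upper bound of the negative of the augmented Lagrangian by the squared distance to a
multiplier. -/
theorem neg_lag_le (hf : IsGammaZero f) (hg : IsGammaZero g) (hγ : 0 < γ)
    (h : OptCond f g A γ μ y x z) {q : Y} (hq : q ∈ multipliers f g A xs) :
    -lag f g A γ x z y ≤
      -((f xs).toReal + (g (A xs)).toReal) + ‖y - q‖ ^ 2 / (2 * γ) := by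
  have h1 := (hg.mem_subdiff_iff.1 hq.1).2 z h.mem_g
  have h2 := (hf.mem_subdiff_iff.1 hq.2).2 x h.mem_f
  rw [inner_neg_left, inner_adjoint_left, map_sub, inner_sub_right] at h2
  rw [inner_sub_right] at h1
  -- This square is exactly the slack left after the two subgradient inequalities at `q`.
  have h3 : 0 ≤ ‖(y - q) + γ • (A x - z)‖ ^ 2 / (2 * γ) := by positivity
  have e : ‖(y - q) + γ • (A x - z)‖ ^ 2 / (2 * γ) =
      ‖y - q‖ ^ 2 / (2 * γ) + (inner ℝ y (A x - z) - (inner ℝ q (A x) - inner ℝ q z)) +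
        γ / 2 * ‖A x - z‖ ^ 2 := by
    rw [norm_add_sq_real, norm_smul, inner_smul_right, mul_pow, Real.norm_eq_abs, sq_abs,
      inner_sub_left, inner_sub_right q]
    field_simp
  rw [e] at h3
  rw [lag]
  linarith

/-- Strong monotonicity estimate of the primal error. -/
theorem mul_sq_norm_sub_le (hf : IsGammaZero f) (hg : IsGammaZero g) (hγ : 0 < γ)
    (h : OptCond f g A γ μ y x z) {q : Y} (hq : q ∈ multipliers f g A xs) :
    μ / 2 * ‖x - xs‖ ^ 2 ≤ ‖y + γ • (A x - z) - q‖ * ‖A x - z‖ +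
      γ * ‖A‖ * ‖A x - z‖ * ‖x - xs‖ := by
  set s := A x - z with hs
  set w := y + γ • s with hw
  obtain ⟨hxg, h1⟩ := hg.mem_subdiff_iff.1 hq.1
  obtain ⟨hxf, h2⟩ := hf.mem_subdiff_iff.1 hq.2
  have h1 := h1 z h.mem_g
  have h2 := h2 x h.mem_f
  have h3 := h.le_f xs hxf
  have h4 := h.le_g _ hxg
  rw [inner_neg_left, inner_adjoint_left, map_sub, inner_sub_right] at h2
  rw [map_sub, norm_sub_rev, inner_sub_right] at h3
  rw [inner_sub_right] at h1
  rw [← hs, ← hw, inner_sub_right] at h4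
  have h5 := (abs_le.1 (abs_real_inner_le_norm (w - q) s)).1
  have h8 : γ * (inner ℝ s (A x) - inner ℝ s (A xs)) ≤ γ * ‖A‖ * ‖s‖ * ‖x - xs‖ := by
    have h7 : inner ℝ s (A (x - xs)) ≤ ‖s‖ * (‖A‖ * ‖x - xs‖) :=
      (real_inner_le_norm _ _).trans (by gcongr; exact A.le_opNorm _)
    rw [map_sub, inner_sub_right] at h7
    have := mul_le_mul_of_nonneg_left h7 hγ.le
    linarith
  have e1 : ∀ u, inner ℝ w u = inner ℝ y u + γ * inner ℝ s u := by
    intro u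
    rw [hw, inner_add_left, inner_smul_left, conj_trivial]
  have e2 : inner ℝ (w - q) s =
      inner ℝ w (A x) - inner ℝ w z - inner ℝ q (A x) + inner ℝ q z := by
    rw [hs, inner_sub_left, inner_sub_right, inner_sub_right]; ring
  have e3 := e1 (A x)
  have e4 := e1 (A xs)
  linarith

end OptCond

/-- Only the acceptance test and the closing step from the trial point enter; neither `d` nor the
size of `τ` matters. -/
theorem LineSearchStep.dual_le (hf : IsGammaZero f) (hg : IsGammaZero g)
    (hfμ : HasConvexityModulus μ f) (hγ : 0 < γ) (hγ' : γ * ‖A‖ ^ 2 ≤ μ) {β : ℝ} {d y' : Y}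
    (h : OptCond f g A γ μ y x z) (hstep : LineSearchStep f g A γ β y d x z y') :
    dual f g A y' ≤ ((-lag f g A γ x z y : ℝ) : EReal) := by
  obtain ⟨τ, xt, zt, -, ⟨halt, hle⟩, rfl⟩ := hstep
  have ht := halt.optCond hf hg hfμ
  rw [augLag_eq hf hg h.mem_f h.mem_g, augLag_eq hf hg ht.mem_f ht.mem_g,
    EReal.coe_le_coe_iff] at hle
  exact (ht.dual_add_le hf hg hγ hγ').trans (EReal.coe_le_coe_iff.2 (neg_le_neg hle))

theorem IsRun.dual_succ_le (hf : IsGammaZero f) (hg : IsGammaZero g)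
    (hfμ : HasConvexityModulus μ f) (hγ : 0 < γ) (hγ' : γ * ‖A‖ ^ 2 ≤ μ) {β : ℝ}
    {y z : ℕ → Y} {x : ℕ → X} (hrun : IsRun f g A γ β y x z) (k : ℕ) :
    dual f g A (y (k + 1)) ≤ ((-lag f g A γ (x k) (z k) (y k) : ℝ) : EReal) := by
  have hk := (hrun.altMin k).optCond hf hg hfμ
  rcases hrun.step k with ⟨d, hd⟩ | ⟨hz, hy⟩
  · exact hd.dual_le hf hg hfμ hγ hγ' hk
  · have := hk.dual_add_le hf hg hγ hγ'
    rw [hz, sub_self, smul_zero, add_zero] at this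
    rwa [hy]

end Iteration

end NAMA

namespace NAMA

/-! ### The local error bound -/

section Convergence

variable {X Y : Type*} [NormedAddCommGroup X] [InnerProductSpace ℝ X] [FiniteDimensional ℝ X]
  [NormedAddCommGroup Y] [InnerProductSpace ℝ Y] [FiniteDimensional ℝ Y]
  {f : X → EReal} {g : Y → EReal} {A : X →L[ℝ] Y} {γ μ : ℝ} {xs : X}

theorem isClosed_multipliers (hf : IsGammaZero f) (hg : IsGammaZero g) :
    IsClosed (multipliers f g A xs) := by
  rw [← isSeqClosed_iff_isClosed]
  intro u q hu huq
  have hc : Continuous fun q => -(LinearMap.adjoint (A : X →ₗ[ℝ] Y) q) :=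
    (LinearMap.continuous_of_finiteDimensional _).neg
  exact ⟨hg.mem_subdiff_of_tendsto huq tendsto_const_nhds (Eventually.of_forall fun k => (hu k).1),
    hf.mem_subdiff_of_tendsto ((hc.tendsto q).comp huq) tendsto_const_nhds
      (Eventually.of_forall fun k => (hu k).2)⟩

theorem isCompact_multipliers (hf : IsGammaZero f) (hg : IsGammaZero g)
    (hstrong : (0 : Y) ∈ interior (dom g - A '' dom f)) : IsCompact (multipliers f g A xs) := by
  have : ProperSpace Y := FiniteDimensional.proper ℝ Y
  obtain ⟨R, -, hR⟩ := exists_norm_le_of_dual_le hf hg hstrong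
    (-((f xs).toReal + (g (A xs)).toReal))
  refine Metric.isCompact_of_isClosed_isBounded (isClosed_multipliers hf hg) ?_
  exact (Metric.isBounded_closedBall (x := (0 : Y)) (r := R)).subset fun q hq => by
    simpa using hR q (dual_le_of_mem_multipliers hf hg hq)

/-- If `t ≥ s`, then `s² ≤ s t`, and a factor `t` cancels. -/
theorem exists_forall_le_mul_of_quadratic {μ a b : ℝ} (hμ : 0 < μ) (ha : 0 ≤ a) (hb : 0 ≤ b) :
    ∃ C : ℝ, 0 ≤ C ∧ ∀ s t : ℝ, 0 ≤ s → 0 ≤ t → μ * t ^ 2 ≤ a * s ^ 2 + b * s * t → t ≤ C * s := by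
  refine ⟨1 + (a + b) / μ, by positivity, fun s t hs ht h => ?_⟩
  have h0 : 0 ≤ (a + b) / μ * s := by positivity
  rcases le_total t s with hts | hst
  · linarith
  · rcases ht.eq_or_lt with rfl | ht
    · linarith
    · have h1 : a * s ^ 2 ≤ a * (s * t) := by rw [sq]; gcongr
      have h2 : t * (μ * t) ≤ t * ((a + b) * s) := by linarith
      have h3 : t ≤ (a + b) / μ * s := by
        rw [div_mul_eq_mul_div, le_div_iff₀' hμ]
        exact le_of_mul_le_mul_left h2 ht
      linarith

/-- Local error bound: the distance of an iterate to the set of multipliers is controlled by the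
residual `A x - z`. -/
theorem exists_error_bound (hf : IsGammaZero f) (hg : IsGammaZero g) (hμ : 0 < μ)
    (hstrong : (0 : Y) ∈ interior (dom g - A '' dom f)) (hxf : xs ∈ dom f) (hxg : A xs ∈ dom g)
    (hstrict : (0 : X) ∈ intrinsicInterior ℝ (subdiff (primal f g A) xs))
    (hcalmf : CalmAt (subdiff f) xs) (hcalmg : CalmAt (subdiff g) (A xs)) (hγ : 0 < γ) (R : ℝ) :
    ∃ U : Set Y, IsOpen U ∧ multipliers f g A xs ⊆ U ∧ ∃ C : ℝ, 0 ≤ C ∧ ∀ y x z,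
      OptCond f g A γ μ y x z → y ∈ U → y + γ • (A x - z) ∈ U →
      ‖y + γ • (A x - z)‖ ≤ R → ‖z - A xs‖ ≤ 1 →
      ∃ q ∈ multipliers f g A xs, ‖y - q‖ ≤ C * ‖A x - z‖ := by
  set B := LinearMap.adjoint (A : X →ₗ[ℝ] Y) with hB
  have hBc : Continuous fun q => -(B q) := (LinearMap.continuous_of_finiteDimensional _).neg
  have hS := isCompact_multipliers (xs := xs) hf hg hstrong
  obtain ⟨U₁, hU₁, hSU₁, L₁, hL₁, h₁⟩ := hcalmf.exists_of_isCompact (hS.image hBc)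
    (by rintro _ ⟨q, hq, rfl⟩; exact hq.2)
  obtain ⟨U₂, hU₂, hSU₂, L₂, hL₂, h₂⟩ := hcalmg.exists_of_isCompact hS (fun q hq => hq.1)
  -- The calmness point `q` lies within `L₂ * ‖z - A xs‖ ≤ L₂` of `w`, and `‖w‖ ≤ R`.
  obtain ⟨κ, hκ, hreg⟩ := exists_multiplier_norm_sub_le hf hg hstrong hxf hxg hstrict (R + L₂)
  set a := L₁ + ‖A‖ * (L₂ * ‖A‖)
  set b := ‖A‖ * γ + ‖A‖ * L₂
  -- The coefficients come from inserting the bound `hwq'` on `‖w - q'‖` into the strong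
  -- monotonicity estimate.
  obtain ⟨C, hC, hquad⟩ := exists_forall_le_mul_of_quadratic (a := L₂ + κ * b)
    (b := L₂ * ‖A‖ + κ * a + γ * ‖A‖) (half_pos hμ) (by positivity) (by positivity)
  refine ⟨(fun q => -(B q)) ⁻¹' U₁ ∩ U₂, (hU₁.preimage hBc).inter hU₂,
    fun q hq => ⟨hSU₁ (mem_image_of_mem _ hq), hSU₂ hq⟩,
    γ + (L₂ + κ * b) + (L₂ * ‖A‖ + κ * a) * C, by positivity, fun y x z h hy hw hwR hz => ?_⟩
  set s := A x - z with hs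
  set w := y + γ • s with hwdef
  obtain ⟨p, hp, hyp⟩ := h₁ x _ (h.mem_subdiff_f hf hμ.le) hy.1
  obtain ⟨q, hq, hwq⟩ := h₂ z w (h.mem_subdiff_g hg) hw.2
  have hzn : ‖z - A xs‖ ≤ ‖s‖ + ‖A‖ * ‖x - xs‖ := by
    have : z - A xs = -s + A (x - xs) := by rw [hs, map_sub]; abel
    rw [this]
    refine (norm_add_le _ _).trans ?_
    rw [norm_neg]
    gcongr
    exact A.le_opNorm _
  have hqR : ‖q‖ ≤ R + L₂ := by
    have h3 : ‖q‖ ≤ ‖w‖ + ‖w - q‖ := by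
      rw [← norm_neg (w - q), neg_sub]
      simpa using norm_add_le w (q - w)
    have h4 : L₂ * ‖z - A xs‖ ≤ L₂ * 1 := by gcongr
    linarith
  obtain ⟨q', hq', hqq'⟩ := hreg q hq hqR p hp
  have he : ‖p + B q‖ ≤ a * ‖x - xs‖ + b * ‖s‖ := by
    have e : p + B q = -(-(B y) - p) + B (γ • s) + -(B (w - q)) := by
      rw [map_sub, hwdef, map_add]; abel
    have h3 : ‖B (γ • s)‖ ≤ ‖A‖ * (γ * ‖s‖) := by
      refine (norm_adjoint_le A _).trans ?_
      rw [norm_smul, Real.norm_of_nonneg hγ.le]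
    have h4 : ‖B (w - q)‖ ≤ ‖A‖ * (L₂ * (‖s‖ + ‖A‖ * ‖x - xs‖)) := by
      refine (norm_adjoint_le A _).trans ?_
      gcongr
      exact hwq.trans (by gcongr)
    calc ‖p + B q‖ ≤ ‖-(B y) - p‖ + ‖B (γ • s)‖ + ‖B (w - q)‖ := by
          rw [e]
          refine (norm_add₃_le).trans ?_
          rw [norm_neg, norm_neg]
      _ ≤ L₁ * ‖x - xs‖ + ‖A‖ * (γ * ‖s‖) + ‖A‖ * (L₂ * (‖s‖ + ‖A‖ * ‖x - xs‖)) := by gcongr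
      _ = a * ‖x - xs‖ + b * ‖s‖ := by ring
  have hwq' : ‖w - q'‖ ≤ (L₂ + κ * b) * ‖s‖ + (L₂ * ‖A‖ + κ * a) * ‖x - xs‖ := by
    calc ‖w - q'‖ ≤ ‖w - q‖ + ‖q - q'‖ := norm_sub_le_norm_sub_add_norm_sub _ _ _
      _ ≤ L₂ * (‖s‖ + ‖A‖ * ‖x - xs‖) + κ * (a * ‖x - xs‖ + b * ‖s‖) := by
          gcongr
          · exact hwq.trans (by gcongr)
          · exact hqq'.trans (by gcongr)
      _ = _ := by ring
  have hx : ‖x - xs‖ ≤ C * ‖s‖ := by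
    refine hquad _ _ (norm_nonneg _) (norm_nonneg _) ?_
    have h3 := h.mul_sq_norm_sub_le hf hg hγ hq'
    have h4 := mul_le_mul_of_nonneg_right hwq' (norm_nonneg s)
    rw [← hs, ← hwdef] at h3
    linarith
  refine ⟨q', hq', ?_⟩
  have h5 : ‖y - q'‖ ≤ γ * ‖s‖ + ‖w - q'‖ := by
    have e : y - q' = -(γ • s) + (w - q') := by rw [hwdef]; abel
    rw [e]
    refine (norm_add_le _ _).trans ?_
    rw [norm_neg, norm_smul, Real.norm_of_nonneg hγ.le]
  have h6 : (L₂ * ‖A‖ + κ * a) * ‖x - xs‖ ≤ (L₂ * ‖A‖ + κ * a) * (C * ‖s‖) := by gcongr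
  linarith

theorem exists_le_mul_pow_of_eventually {u : ℕ → ℝ} {c : ℝ} (hc : c ∈ Ioo (0 : ℝ) 1)
    (h : ∀ᶠ k in atTop, u (k + 1) ≤ c * u k) :
    ∃ C : ℝ, 0 ≤ C ∧ ∀ᶠ k in atTop, u k ≤ C * c ^ k := by
  obtain ⟨K, hK⟩ := eventually_atTop.1 h
  have h1 : ∀ n, u (K + n) ≤ |u K| * c ^ n := by
    intro n
    induction n with
    | zero => simpa using le_abs_self _
    | succ n ih =>
      calc u (K + (n + 1)) ≤ c * u (K + n) := hK _ (Nat.le_add_right _ _)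
        _ ≤ c * (|u K| * c ^ n) := by gcongr; exact hc.1.le
        _ = |u K| * c ^ (n + 1) := by ring
  refine ⟨|u K| / c ^ K, div_nonneg (abs_nonneg _) (pow_nonneg hc.1.le _), ?_⟩
  filter_upwards [eventually_ge_atTop K] with k hk
  obtain ⟨n, rfl⟩ := Nat.exists_eq_add_of_le hk
  refine (h1 n).trans (le_of_eq ?_)
  have := (pow_pos hc.1 K).ne'
  rw [pow_add]; field_simp

end Convergence

end NAMA

namespace NAMA

/-! ### Limits of the iterates -/

section Convergence

variable {X Y : Type*} [NormedAddCommGroup X] [InnerProductSpace ℝ X] [FiniteDimensional ℝ X]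
  [NormedAddCommGroup Y] [InnerProductSpace ℝ Y] [FiniteDimensional ℝ Y]
  {f : X → EReal} {g : Y → EReal} {A : X →L[ℝ] Y} {γ μ : ℝ} {xs : X}

theorem multipliers_nonempty (hf : IsGammaZero f) (hg : IsGammaZero g)
    (hstrong : (0 : Y) ∈ interior (dom g - A '' dom f)) (hxf : xs ∈ dom f) (hxg : A xs ∈ dom g)
    (hxs : IsMinOn (primal f g A) univ xs) : (multipliers f g A xs).Nonempty := by
  obtain ⟨q, hq, hq'⟩ := exists_mem_subdiff_of_mem_subdiff_primal hf hg hstrong hxf hxg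
    (v := 0) (fun x => by simpa using hxs (mem_univ x))
  exact ⟨q, hq, by rwa [zero_sub] at hq'⟩

/-- If the residuals `A x - z` of bounded dual points tend to zero, then the primal points tend to
the primal solution. -/
theorem tendsto_primal_of_residual (hf : IsGammaZero f) (hg : IsGammaZero g) (hμ : 0 < μ)
    (hγ : 0 < γ) {q : Y} (hq : q ∈ multipliers f g A xs) {y z : ℕ → Y} {x : ℕ → X}
    (h : ∀ k, OptCond f g A γ μ (y k) (x k) (z k)) {R : ℝ}
    (hw : ∀ᶠ k in atTop, ‖y k + γ • (A (x k) - z k)‖ ≤ R)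
    (hs : Tendsto (fun k => A (x k) - z k) atTop (𝓝 0)) : Tendsto x atTop (𝓝 xs) := by
  rw [tendsto_iff_norm_sub_tendsto_zero]
  have hs' : Tendsto (fun k => ‖A (x k) - z k‖) atTop (𝓝 0) := by simpa using hs.norm
  -- This dominates `‖x k - xs‖²`: it solves `μ/2 t² ≤ (R + ‖q‖)‖s‖ + c t`, with `c = γ‖A‖‖s‖`, by
  -- absorbing the linear term through `(2c - μt)² ≥ 0`.
  have hb : Tendsto (fun k => 4 / μ * ((R + ‖q‖) * ‖A (x k) - z k‖) +
      4 / μ ^ 2 * (γ * ‖A‖ * ‖A (x k) - z k‖) ^ 2) atTop (𝓝 0) := by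
    have := ((hs'.const_mul (R + ‖q‖)).const_mul (4 / μ)).add
      (((hs'.const_mul (γ * ‖A‖)).pow 2).const_mul (4 / μ ^ 2))
    simpa using this
  have hsq : Tendsto (fun k => ‖x k - xs‖ ^ 2) atTop (𝓝 0) := by
    refine squeeze_zero' (Eventually.of_forall fun k => sq_nonneg _) ?_ hb
    filter_upwards [hw] with k hk
    have h1 := (h k).mul_sq_norm_sub_le hf hg hγ hq
    set s := A (x k) - z k
    set c := γ * ‖A‖ * ‖s‖
    have h2 : ‖y k + γ • s - q‖ * ‖s‖ ≤ (R + ‖q‖) * ‖s‖ := by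
      gcongr
      exact (norm_sub_le _ _).trans (by gcongr)
    have h3 : 0 ≤ (2 * c - μ * ‖x k - xs‖) ^ 2 := sq_nonneg _
    have h4 : μ ^ 2 * ‖x k - xs‖ ^ 2 ≤ 4 * μ * ((R + ‖q‖) * ‖s‖) + 4 * c ^ 2 := by
      have h5 := mul_le_mul_of_nonneg_left (h1.trans (add_le_add_left h2 _)) hμ.le
      linarith
    have e : 4 / μ * ((R + ‖q‖) * ‖s‖) + 4 / μ ^ 2 * c ^ 2 =
        (4 * μ * ((R + ‖q‖) * ‖s‖) + 4 * c ^ 2) / μ ^ 2 := by field_simp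
    rw [e, le_div_iff₀' (by positivity)]
    exact h4
  have := hsq.sqrt
  simpa using this

/-- Limits of the dual iterates are multipliers. -/
theorem mem_multipliers_of_tendsto (hf : IsGammaZero f) (hg : IsGammaZero g) (hμ : 0 < μ)
    {y z : ℕ → Y} {x : ℕ → X} (h : ∀ k, OptCond f g A γ μ (y k) (x k) (z k)) {l : Filter ℕ}
    [l.NeBot] {a : Y} (hy : Tendsto y l (𝓝 a)) (hx : Tendsto x l (𝓝 xs))
    (hs : Tendsto (fun k => A (x k) - z k) l (𝓝 0)) : a ∈ multipliers f g A xs := by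
  have hz : Tendsto z l (𝓝 (A xs)) := by
    have := ((A.continuous.tendsto xs).comp hx).sub hs
    simpa using this
  have hw : Tendsto (fun k => y k + γ • (A (x k) - z k)) l (𝓝 a) := by
    have := hy.add (hs.const_smul γ)
    simpa using this
  have hc : Continuous fun q => -(LinearMap.adjoint (A : X →ₗ[ℝ] Y) q) :=
    (LinearMap.continuous_of_finiteDimensional _).neg
  exact ⟨hg.mem_subdiff_of_tendsto hw hz (Eventually.of_forall fun k => (h k).mem_subdiff_g hg),
    hf.mem_subdiff_of_tendsto ((hc.tendsto a).comp hy) hx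
      (Eventually.of_forall fun k => (h k).mem_subdiff_f hf hμ.le)⟩

end Convergence

end NAMA

/-! ### Linear convergence -/

theorem mainTheorem7
    {X Y : Type*} [NormedAddCommGroup X] [InnerProductSpace ℝ X] [FiniteDimensional ℝ X]
    [NormedAddCommGroup Y] [InnerProductSpace ℝ Y] [FiniteDimensional ℝ Y]
    (f : X → EReal) (g : Y → EReal) (A : X →L[ℝ] Y) (μ : ℝ)
    (hf : NAMA.IsGammaZero f) (hg : NAMA.IsGammaZero g)
    (hμ : 0 < μ) (hfμ : NAMA.HasConvexityModulus μ f)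
    (hfeas : (A '' NAMA.dom f ∩ NAMA.dom g).Nonempty)
    (xs : X) (hxs : IsMinOn (NAMA.primal f g A) univ xs)
    (hstrong : (0 : Y) ∈ interior (NAMA.dom g - A '' NAMA.dom f))
    (hstrict : (0 : X) ∈ intrinsicInterior ℝ (NAMA.subdiff (NAMA.primal f g A) xs))
    (hcalmf : NAMA.CalmAt (NAMA.subdiff f) xs)
    (hcalmg : NAMA.CalmAt (NAMA.subdiff g) (A xs))
    (γ β : ℝ) (hγ : 0 < γ) (hγ' : γ * ‖A‖ ^ 2 < μ) (hβ : β ∈ Ioo (0 : ℝ) 1)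
    (y : ℕ → Y) (x : ℕ → X) (z : ℕ → Y) (hrun : NAMA.IsRun f g A γ β y x z) :
    (∃ (p : ℕ → ℝ) (L : ℝ),
      (⨅ w, NAMA.dual f g A w) = (L : EReal) ∧
      (∀ᶠ k in atTop, NAMA.dual f g A (y k) = (p k : EReal)) ∧
      NAMA.QLinear p L) ∧
    NAMA.RLinear x xs := by
  obtain ⟨hxf, hxg⟩ := NAMA.mem_dom_of_isMinOn_primal hf hg hfeas hxs
  obtain ⟨q₀, hq₀⟩ := NAMA.multipliers_nonempty hf hg hstrong hxf hxg hxs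
  have hopt : ∀ k, NAMA.OptCond f g A γ μ (y k) (x k) (z k) :=
    fun k => (hrun.altMin k).optCond hf hg hfμ
  have hdec := hrun.dual_succ_le hf hg hfμ hγ hγ'.le
  set L : ℝ := -((f xs).toReal + (g (A xs)).toReal) with hL
  set l : ℕ → ℝ := fun k => -NAMA.lag f g A γ (x k) (z k) (y k) with hl
  set s : ℕ → Y := fun k => A (x k) - z k with hs
  set p : ℕ → ℝ := fun k => (NAMA.dual f g A (y k)).toReal with hp
  have hlow : ∀ w, (L : EReal) ≤ NAMA.dual f g A w := fun w => by
    refine le_trans (EReal.coe_le_coe_iff.2 (le_of_eq ?_)) (NAMA.le_dual hf hg hxf hxg w)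
    rw [sub_self, inner_zero_right, hL]; ring
  have hinf : (⨅ w, NAMA.dual f g A w) = (L : EReal) :=
    le_antisymm ((iInf_le _ q₀).trans (NAMA.dual_le_of_mem_multipliers hf hg hq₀))
      (le_iInf hlow)
  -- The arbitrary `y 0` may have infinite dual value, so all estimates on `p` start at index `1`.
  have hpe : ∀ k, NAMA.dual f g A (y (k + 1)) = (p (k + 1) : EReal) := fun k =>
    (EReal.coe_toReal ((hdec k).trans_lt (EReal.coe_lt_top _)).ne
      ((EReal.bot_lt_coe _).trans_le (hlow _)).ne').symm
  have hpl : ∀ k, p (k + 1) ≤ l k := fun k => by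
    have := hdec k
    rwa [hpe, EReal.coe_le_coe_iff] at this
  have hlp : ∀ k, l (k + 1) + γ / 2 * ‖s (k + 1)‖ ^ 2 ≤ p (k + 1) := fun k => by
    have := (hopt (k + 1)).lag_le_dual hf hg
    rwa [hpe, EReal.coe_le_coe_iff] at this
  have hxp : ∀ k, L + μ / 2 * ‖x (k + 1) - xs‖ ^ 2 ≤ p (k + 1) := fun k => by
    have := (hopt (k + 1)).sq_norm_sub_le_dual hf hg hxf hxg
    rwa [hpe, EReal.coe_le_coe_iff] at this
  have hLp : ∀ k, L ≤ p (k + 1) := fun k => by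
    have := hlow (y (k + 1))
    rwa [hpe, EReal.coe_le_coe_iff] at this
  have hstep : ∀ k, γ / 2 * ‖s (k + 1)‖ ^ 2 ≤ p (k + 1) - p (k + 1 + 1) := fun k => by
    linarith [hlp k, hpl (k + 1)]
  have hanti : Antitone fun k => p (k + 1) := antitone_nat_of_succ_le fun k => by
    have h1 : 0 ≤ γ / 2 * ‖s (k + 1)‖ ^ 2 := by positivity
    linarith [hstep k]
  -- the residuals tend to zero
  have hs0 : Tendsto s atTop (𝓝 0) := by
    have hlim := tendsto_atTop_ciInf hanti ⟨L, by rintro _ ⟨k, rfl⟩; exact hLp k⟩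
    have h1 : Tendsto (fun k => 2 / γ * (p (k + 1) - p (k + 1 + 1))) atTop (𝓝 0) := by
      have := (hlim.sub (hlim.comp (tendsto_add_atTop_nat 1))).const_mul (2 / γ)
      simpa using this
    have h2 : Tendsto (fun k => ‖s (k + 1)‖ ^ 2) atTop (𝓝 0) := by
      refine squeeze_zero (fun k => sq_nonneg _) (fun k => ?_) h1
      have h3 := mul_le_mul_of_nonneg_left (hstep k) (by positivity : 0 ≤ 2 / γ)
      rwa [← mul_assoc, show 2 / γ * (γ / 2) = 1 by field_simp, one_mul] at h3
    have h3 := h2.sqrt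
    simp only [Real.sqrt_sq (norm_nonneg _), Real.sqrt_zero] at h3
    exact (tendsto_add_atTop_iff_nat 1).1 (tendsto_zero_iff_norm_tendsto_zero.2 h3)
  have hγs : Tendsto (fun k => γ • s k) atTop (𝓝 0) := by simpa using hs0.const_smul γ
  -- the iterates are bounded and approach the set of multipliers
  obtain ⟨R, hR0, hR⟩ := NAMA.exists_norm_le_of_dual_le hf hg hstrong (p 1)
  have hyR : ∀ᶠ k in atTop, ‖y k‖ ≤ R := by
    filter_upwards [eventually_ge_atTop 1] with k hk
    obtain ⟨k, rfl⟩ := Nat.exists_eq_add_of_le' hk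
    exact hR _ ((hpe k).trans_le (EReal.coe_le_coe_iff.2 (hanti (Nat.zero_le k))))
  have hwR : ∀ᶠ k in atTop, ‖y k + γ • s k‖ ≤ R + 1 := by
    have h1 : ∀ᶠ k in atTop, ‖γ • s k‖ < 1 := by
      have := hγs.norm
      rw [norm_zero] at this
      exact this.eventually_lt_const one_pos
    filter_upwards [hyR, h1] with k hk hk1
    exact (norm_add_le _ _).trans (by linarith)
  have hx : Tendsto x atTop (𝓝 xs) :=
    NAMA.tendsto_primal_of_residual hf hg hμ hγ hq₀ hopt hwR hs0
  obtain ⟨U, hU, hSU, C, hC, herr⟩ := NAMA.exists_error_bound hf hg hμ hstrong hxf hxg hstrict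
    hcalmf hcalmg hγ (R + 1)
  have hyU : ∀ᶠ k in atTop, y k ∈ U := by
    refine NAMA.eventually_mem_of_clusterPt hyR hU fun a ha => hSU ?_
    obtain ⟨V, hV, hVa⟩ := mapClusterPt_iff_ultrafilter.1 ha
    exact NAMA.mem_multipliers_of_tendsto hf hg hμ hopt hVa (hx.mono_left hV) (hs0.mono_left hV)
  have hwU : ∀ᶠ k in atTop, y k + γ • s k ∈ U := by
    refine NAMA.eventually_mem_of_clusterPt hwR hU fun a ha => hSU ?_
    obtain ⟨V, hV, hVa⟩ := mapClusterPt_iff_ultrafilter.1 ha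
    refine NAMA.mem_multipliers_of_tendsto hf hg hμ hopt (l := V) ?_ (hx.mono_left hV)
      (hs0.mono_left hV)
    have := hVa.sub (hγs.mono_left hV)
    simpa using this
  have hz : ∀ᶠ k in atTop, ‖z k - A xs‖ ≤ 1 := by
    have h1 : Tendsto (fun k => ‖z k - A xs‖) atTop (𝓝 0) := by
      have := (((A.continuous.tendsto xs).comp hx).sub hs0).sub_const (A xs)
      simpa [hs] using this.norm
    exact (h1.eventually_lt_const one_pos).mono fun k hk => hk.le
  -- linear decrease of the dual objective
  set c : ℝ := 1 / (1 + γ ^ 2 / (C + 1) ^ 2) with hc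
  have hc0 : 0 < γ ^ 2 / (C + 1) ^ 2 := by positivity
  have hcI : c ∈ Ioo (0 : ℝ) 1 := ⟨by positivity, by rw [hc, div_lt_one (by positivity)]; linarith⟩
  have hlin : ∀ᶠ k in atTop, p (k + 1) - L ≤ c * (p k - L) := by
    filter_upwards [hyU, hwU, hwR, hz, eventually_ge_atTop 1] with k h1 h2 h3 h4 hk
    obtain ⟨q, hq, hyq⟩ := herr _ _ _ (hopt k) h1 h2 h3 h4
    obtain ⟨k, rfl⟩ := Nat.exists_eq_add_of_le' hk
    have h5 := (hopt (k + 1)).neg_lag_le hf hg hγ hq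
    have h6 : ‖y (k + 1) - q‖ ^ 2 ≤ (C + 1) ^ 2 * ‖s (k + 1)‖ ^ 2 := by
      rw [← mul_pow]
      gcongr
      refine hyq.trans ?_
      gcongr
      linarith
    have h7 : l (k + 1) - L ≤ (C + 1) ^ 2 * ‖s (k + 1)‖ ^ 2 / (2 * γ) := by
      have : ‖y (k + 1) - q‖ ^ 2 / (2 * γ) ≤ (C + 1) ^ 2 * ‖s (k + 1)‖ ^ 2 / (2 * γ) := by gcongr
      linarith
    have h8 : γ ^ 2 / (C + 1) ^ 2 * (l (k + 1) - L) ≤ γ / 2 * ‖s (k + 1)‖ ^ 2 := by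
      refine (mul_le_mul_of_nonneg_left h7 hc0.le).trans (le_of_eq ?_)
      field_simp
    have h9 : l (k + 1) - L ≤ c * (p (k + 1) - L) := by
      rw [hc, div_mul_eq_mul_div, le_div_iff₀ (by positivity)]
      linarith [hlp k]
    linarith [hpl (k + 1)]
  have habs : ∀ᶠ k in atTop, |p k - L| = p k - L := by
    filter_upwards [eventually_ge_atTop 1] with k hk
    obtain ⟨k, rfl⟩ := Nat.exists_eq_add_of_le' hk
    exact abs_of_nonneg (sub_nonneg.2 (hLp k))
  obtain ⟨M, hM, hpM⟩ := NAMA.exists_le_mul_pow_of_eventually (u := fun k => p k - L) hcI hlin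
  -- Since `μ / 2 * ‖x k - xs‖²` is at most the dual gap `≤ M * c ^ k`, square roots give the
  -- constants for `x`.
  refine ⟨⟨p, L, hinf, ?_, ?_, c, hcI, ?_⟩, hx, √(2 / μ * M), √c,
    ⟨Real.sqrt_pos.2 hcI.1, by rw [Real.sqrt_lt' one_pos, one_pow]; exact hcI.2⟩, ?_⟩
  · filter_upwards [eventually_ge_atTop 1] with k hk
    obtain ⟨k, rfl⟩ := Nat.exists_eq_add_of_le' hk
    exact hpe k
  · rw [tendsto_iff_norm_sub_tendsto_zero]
    have h1 : Tendsto (fun k => M * c ^ k) atTop (𝓝 0) := by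
      simpa using (tendsto_pow_atTop_nhds_zero_of_lt_one hcI.1.le hcI.2).const_mul M
    refine squeeze_zero' (Eventually.of_forall fun k => norm_nonneg _) ?_ h1
    filter_upwards [habs, hpM] with k h2 h3
    rw [Real.norm_eq_abs, h2]
    exact h3
  · filter_upwards [habs, (tendsto_add_atTop_nat 1).eventually habs, hlin] with k h1 h2 h3
    rwa [h1, h2]
  · filter_upwards [hpM, eventually_ge_atTop 1] with k h1 hk
    obtain ⟨k, rfl⟩ := Nat.exists_eq_add_of_le' hk
    have h2 : ‖x (k + 1) - xs‖ ^ 2 ≤ 2 / μ * M * c ^ (k + 1) := by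
      have h3 : μ / 2 * ‖x (k + 1) - xs‖ ^ 2 ≤ M * c ^ (k + 1) := by linarith [hxp k]
      calc ‖x (k + 1) - xs‖ ^ 2 = 2 / μ * (μ / 2 * ‖x (k + 1) - xs‖ ^ 2) := by field_simp
        _ ≤ 2 / μ * (M * c ^ (k + 1)) := by gcongr
        _ = _ := by ring
    refine (pow_le_pow_iff_left₀ (norm_nonneg _) (by positivity) two_ne_zero).1 ?_
    rw [mul_pow, Real.sq_sqrt (by positivity), ← pow_mul, mul_comm (k + 1) 2, pow_mul,
      Real.sq_sqrt hcI.1.le]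
    exact h2
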